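/- Let $k\ge 1$, $[k]=\{1,\dots,k\}$, and let $[k]^\omega:=\bigcup_{n\ge1}[k]^n$ be the set of nonempty finite words over $[k]$. A combinatorial line is a map $\ell:[k]\to[k]^\omega$ that sends $i$ to the word obtained from a fixed finite word over $[k]\cup\{*\}$, in which the variable $*$ occurs, by replacing every $*$ by $i$. A subspace is a map $\phi:[k]^\omega\to[k]^\omega$ of the form $\phi(v_1\cdots v_n)=\ell_1(v_1)\ell_2(v_2)\cdots\ell_n(v_n)$ (concatenation) for some infinite sequence of combinatorial lines $\ell_1,\ell_2,\dots$. For a standard Borel space $(X,\Sigma)$, a law on $X^{[k]^\omega}$ is a probability measure $\mu$ on $(X^{[k]^\omega},\Sigma^{\otimes[k]^\omega})$. It is strongly stationary (s.s.) if for every subspace $\phi$ the image of $\mu$ under $(x_w)_w\mapsto(x_{\phi(w)})_w$ is $\mu$. For an s.s. law the distribution $\mu^\circ$ on $X$ of $x_w$ does not depend on the word $w$, and the distribution $\mu^{\mathrm{line}}$ on $X^k$ of $(x_{\ell(1)},\dots,x_{\ell(k)})$ does not depend on the combinatorial line $\ell$. A law $\tilde\mu$ on $\tilde X^{[k]^\omega}$,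 with $\tilde X$ standard Borel, is an extension of $\mu$ through a Borel map $\pi:\tilde X\to X$ if $\mu$ is the image of $\tilde\mu$ under $(\tilde x_w)_w\mapsto(\pi(\tilde x_w))_w$. Let $\mu$ be an s.s. law on $X^{[k]^\omega}$. For nonempty $e\subseteq[k]$ let $\Phi_e$ be the $\sigma$-algebra of all $A\in\Sigma$ such that along every combinatorial line $\ell$, for $\mu$-a.e. $(x_w)_w$, $1_A(x_{\ell(i)})=1_A(x_{\ell(j)})$ for all $i,j\in e$. Let $\Phi^\dagger_e$ be the completion of $\pi_i^{-1}(\Phi_e)$ under $\mu^{\mathrm{line}}$ for $i\in e$, where $\pi_i:X^k\to X$ is the $i$-th coordinate; this is the same $\sigma$-algebra for all $i\in e$. Write $\binom{[k]}{\ge2}$ for the family of subsets of $[k]$ with at least two elements; an up-set in it is a subfamily $\mathcal I$ such that $u\in\mathcal I$ and $u\subseteq v\subseteq[k]$ imply $v\in\mathcal I$. For an up-set $\mathcal I$ put $\Phi_{\mathcal I}:=\bigvee_{e\in\mathcal I}\Phi_e$ and $\Phi^\dagger_{\mathcal I}:=\bigvee_{e\in\mathcal I}\Phi^\dagger_e$.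 The s.s. law $\mu$ is fully sated if for every nonempty up-set $\mathcal I\subseteq\binom{[k]}{\ge2}$ and every s.s. extension $\tilde\mu$ of $\mu$, through $\pi:\tilde X\to X$ say, the $\sigma$-algebras $\pi^{-1}(\Sigma)$ and $\tilde\Phi_{\mathcal I}$ are relatively (that is, conditionally) independent over $\pi^{-1}(\Phi_{\mathcal I})$ under $\tilde\mu^\circ$, where $\tilde\Phi_{\mathcal I}$ is the $\sigma$-algebra $\Phi_{\mathcal I}$ formed for $\tilde\mu$. **Theorem.** Let $\mu$ be a fully sated s.s. law and let $\mathcal I,\mathcal I'\subseteq\binom{[k]}{\ge2}$ be up-sets. Then $\Phi^\dagger_{\mathcal I}$ and $\Phi^\dagger_{\mathcal I'}$ are relatively independent over $\Phi^\dagger_{\mathcal I\cap\mathcal I'}$ under (the completion of) $\mu^{\mathrm{line}}$. -/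

import Mathlib

open MeasureTheory

universe u

/-! ### Words, lines and subspaces -/

/-- The infinite-dimensional combinatorial space `⋃_{n ≥ 1} [k]^n`: all nonempty finite words
over the alphabet `[k]` (modelled by `Fin k`). -/
abbrev Word (k : ℕ) : Type := {w : List (Fin k) // w ≠ []}

/-- The word consisting of the single letter `i`. -/
def Word.letter {k : ℕ} (i : Fin k) : Word k := ⟨[i], List.cons_ne_nil i []⟩

/-- A variable word: a finite word over `[k] ∪ {variable}` (the variable is `none`) in which the
variable occurs. With `N` the length of the word, this is a nonempty set `I ⊆ [N]` (the positions
of the variable) together with the letters fixed at the positions in `[N] \ I`; thus a variable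
word is the same thing as a combinatorial line. -/
abbrev VarWord (k : ℕ) : Type := {u : List (Option (Fin k)) // none ∈ u}

/-- The `i`-th point of the combinatorial line `ℓ`: put the letter `i` for the variable. -/
def VarWord.subst {k : ℕ} (ℓ : VarWord k) (i : Fin k) : Word k :=
  ⟨ℓ.1.map (fun o => o.getD i), fun h => by
    have h' := ℓ.2
    rw [List.map_eq_nil_iff.mp h] at h'
    exact List.not_mem_nil h'⟩

/-- The data of an infinite-dimensional subspace of the combinatorial space: the numbers
`0 = N 0 < N 1 < ...`, the nonempty sets `I (i+1) ⊆ (N i, N (i+1)]` and the letters fixed at the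
remaining places form a sequence of variable words, the `i`-th of which has length
`N (i+1) - N i`. -/
abbrev CombSubspace (k : ℕ) : Type := ℕ → VarWord k

/-- The injection of the combinatorial space into itself that a subspace `φ` specifies:
`v₀ v₁ ⋯ vₙ₋₁` goes to the concatenation `φ₀(v₀) φ₁(v₁) ⋯ φₙ₋₁(vₙ₋₁)`. -/
def CombSubspace.map {k : ℕ} (φ : CombSubspace k) (v : Word k) : Word k :=
  ⟨(v.1.mapIdx fun i a => ((φ i).subst a).1).flatten, by
    obtain ⟨v, hv⟩ := v
    cases v with
    | nil => exact absurd rfl hv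
    | cons a v =>
      intro h
      rw [List.mapIdx_cons, List.flatten_cons, List.append_eq_nil_iff] at h
      exact ((φ 0).subst a).2 h.1⟩

/-! ### Laws -/

/-- Strong stationarity of a law `μ` on `X^{[k]^ω}`: for every subspace `φ` the image of `μ` under
`(x_w)_w ↦ (x_{φ(w)})_w` is `μ`. -/
def IsStronglyStationary {k : ℕ} {X : Type u} [MeasurableSpace X]
    (μ : Measure (Word k → X)) : Prop :=
  ∀ φ : CombSubspace k, μ.map (fun x w => x (φ.map w)) = μ

/-- The point-marginal of `μ`. For a strongly stationary law all one-dimensional marginals agree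
(see `map_eval_eq_pointMarginal`); we read it off at a word of length one. -/
noncomputable def pointMarginal {k : ℕ} [NeZero k] {X : Type u} [MeasurableSpace X]
    (μ : Measure (Word k → X)) : Measure X :=
  μ.map (fun x => x (Word.letter 0))

/-- The line-marginal of `μ`. For a strongly stationary law the marginals along all combinatorial
lines agree (see `map_line_eq_lineMarginal`); we read it off at the line of words of length
one. -/
noncomputable def lineMarginal {k : ℕ} {X : Type u} [MeasurableSpace X]
    (μ : Measure (Word k → X)) : Measure (Fin k → X) :=
  μ.map (fun x i => x (Word.letter i))

theorem map_line_eq_lineMarginal {k : ℕ} {X : Type u} [MeasurableSpace X]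
    {μ : Measure (Word k → X)} (hμ : IsStronglyStationary μ) (ℓ : VarWord k) :
    μ.map (fun x i => x (ℓ.subst i)) = lineMarginal μ := by
  have h := hμ (fun _ => ℓ)
  unfold lineMarginal
  conv_rhs => rw [← h]
  rw [Measure.map_map (by fun_prop) (by fun_prop)]
  congr 1
  funext x i
  simp only [Function.comp]
  congr 1
  apply Subtype.ext
  simp [CombSubspace.map, Word.letter]

theorem map_line_apply_eq {k : ℕ} {X : Type u} [MeasurableSpace X]
    {μ : Measure (Word k → X)} (hμ : IsStronglyStationary μ) (ℓ : VarWord k) (i : Fin k) :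
    μ.map (fun x => x (ℓ.subst i)) = μ.map (fun x => x (Word.letter i)) := by
  have h := congrArg (Measure.map (fun y : Fin k → X => y i)) (map_line_eq_lineMarginal hμ ℓ)
  unfold lineMarginal at h
  rwa [Measure.map_map (by fun_prop) (by fun_prop),
    Measure.map_map (by fun_prop) (by fun_prop)] at h

theorem map_eval_eq_pointMarginal {k : ℕ} [NeZero k] {X : Type u} [MeasurableSpace X]
    {μ : Measure (Word k → X)} (hμ : IsStronglyStationary μ) (w : Word k) :
    μ.map (fun x => x w) = pointMarginal μ := by
  obtain ⟨l, hl⟩ := w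
  cases l with
  | nil => exact absurd rfl hl
  | cons i l =>
    have h1 := map_line_apply_eq hμ ⟨none :: l.map some, by simp⟩ i
    have h2 := map_line_apply_eq hμ ⟨[none, some 0], by simp⟩ i
    have h3 := map_line_apply_eq hμ ⟨[some i, none], by simp⟩ 0
    have e1 : VarWord.subst ⟨none :: l.map some, by simp⟩ i = (⟨i :: l, hl⟩ : Word k) := by
      apply Subtype.ext
      simp [VarWord.subst, Function.comp_def]
    have e2 : VarWord.subst ⟨[none, some 0], by simp⟩ i
        = VarWord.subst ⟨[some i, none], by simp⟩ (0 : Fin k) := by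
      apply Subtype.ext
      simp [VarWord.subst]
    rw [e1] at h1
    rw [e2] at h2
    exact h1.trans (h2.symm.trans h3)

/-- The law `ν` on `Y^{[k]^ω}` is an extension of the law `μ` on `X^{[k]^ω}` through the Borel
map `π : Y → X`. -/
def IsExtension {k : ℕ} {X Y : Type u} [MeasurableSpace X] [MeasurableSpace Y]
    (ν : Measure (Word k → Y)) (μ : Measure (Word k → X)) (π : Y → X) : Prop :=
  Measurable π ∧ ν.map (fun y w => π (y w)) = μ

/-! ### Relative independence -/

/-- The `σ`-subalgebras `m₁` and `m₂` are relatively (that is, conditionally) independent over the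
`σ`-subalgebra `m'` under `μ`. -/
def RelIndep {Ω : Type u} [mΩ : MeasurableSpace Ω] (μ : Measure Ω)
    (m' m₁ m₂ : MeasurableSpace Ω) : Prop :=
  (m' ≤ mΩ ∧ m₁ ≤ mΩ ∧ m₂ ≤ mΩ) ∧
  ∀ A B : Set Ω, MeasurableSet[m₁] A → MeasurableSet[m₂] B →
    μ[(A ∩ B).indicator (fun _ => (1 : ℝ)) | m'] =ᵐ[μ]
      fun ω => (μ[A.indicator (fun _ => (1 : ℝ)) | m']) ω *
        (μ[B.indicator (fun _ => (1 : ℝ)) | m']) ω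

/-! ### Partially insensitive and oblique `σ`-algebras -/

/-- The `e`-insensitive `σ`-algebra `Φ_e` of `μ`: the measurable `A ⊆ X` such that along every
combinatorial line `ℓ`, almost surely `1_A(x_{ℓ(i)}) = 1_A(x_{ℓ(j)})` for all `i, j ∈ e`. -/
@[reducible] def insensitive {k : ℕ} {X : Type u} [MeasurableSpace X]
    (μ : Measure (Word k → X)) (e : Finset (Fin k)) : MeasurableSpace X where
  MeasurableSet' A := MeasurableSet A ∧ ∀ ℓ : VarWord k, ∀ᵐ x ∂μ,
    ∀ i ∈ e, ∀ j ∈ e, (x (ℓ.subst i) ∈ A ↔ x (ℓ.subst j) ∈ A)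
  measurableSet_empty := ⟨MeasurableSet.empty, fun _ => by simp⟩
  measurableSet_compl A hA := ⟨hA.1.compl, fun ℓ => by
    filter_upwards [hA.2 ℓ] with x hx i hi j hj
    exact not_congr (hx i hi j hj)⟩
  measurableSet_iUnion f hf := ⟨MeasurableSet.iUnion fun n => (hf n).1, fun ℓ => by
    filter_upwards [ae_all_iff.mpr fun n => (hf n).2 ℓ] with x hx i hi j hj
    simp only [Set.mem_iUnion]
    exact exists_congr fun n => hx n i hi j hj⟩

/-- `Φ_I`, the join of the `Φ_e` with `e ∈ I`. -/
@[reducible] def insensitiveJoin {k : ℕ} {X : Type u} [MeasurableSpace X]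
    (μ : Measure (Word k → X)) (I : Set (Finset (Fin k))) : MeasurableSpace X :=
  ⨆ e ∈ I, insensitive μ e

/-- The oblique copy `Φ†_e`, for nonempty `e`: the common completion under the line-marginal of
the `σ`-algebras `π_i⁻¹(Φ_e)`, `i ∈ e`. All these completions agree (see `oblique_eq`), so that
their intersection is each of them. It is a `σ`-subalgebra of the completion of the product
`σ`-algebra of `X^k` under the line-marginal. -/
@[reducible] noncomputable def oblique {k : ℕ} {X : Type u} [MeasurableSpace X]
    (μ : Measure (Word k → X)) (e : Finset (Fin k)) :
    MeasurableSpace (Fin k → X) :=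
  ⨅ i ∈ e, eventuallyMeasurableSpace
    ((insensitive μ e).comap (fun x : Fin k → X => x i)) (ae (lineMarginal μ))

theorem oblique_eq {k : ℕ} {X : Type u} [MeasurableSpace X]
    (μ : Measure (Word k → X)) (e : Finset (Fin k)) (i : Fin k) (hi : i ∈ e) :
    oblique μ e = eventuallyMeasurableSpace
      ((insensitive μ e).comap (fun x : Fin k → X => x i)) (ae (lineMarginal μ)) := by
  refine le_antisymm (iInf₂_le i hi) (le_iInf₂ fun j hj => ?_)
  rintro A ⟨_, ⟨B, hB, rfl⟩, hA⟩
  refine ⟨_, ⟨B, hB, rfl⟩, hA.trans ?_⟩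
  have h : ∀ᵐ y ∂(lineMarginal μ), (y i ∈ B ↔ y j ∈ B) := by
    have hm : MeasurableSet {y : Fin k → X | y i ∈ B ↔ y j ∈ B} :=
      MeasurableSet.iff ((measurable_pi_apply i) hB.1) ((measurable_pi_apply j) hB.1)
    unfold lineMarginal
    rw [ae_map_iff (Measurable.aemeasurable (by fun_prop)) hm]
    filter_upwards [hB.2 ⟨[none], by simp⟩] with x hx
    exact hx i hi j hj
  filter_upwards [h] with y hy
  exact propext hy

/-- `Φ†_I`, the join of the oblique copies `Φ†_e` with `e ∈ I`. -/
@[reducible] noncomputable def obliqueJoin {k : ℕ} {X : Type u} [MeasurableSpace X]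
    (μ : Measure (Word k → X)) (I : Set (Finset (Fin k))) :
    MeasurableSpace (Fin k → X) :=
  ⨆ e ∈ I, oblique μ e

/-! ### Up-sets and sated laws -/

/-- `I` is an up-set in the family of subsets of `[k]` with at least two elements. -/
def IsUpSet {k : ℕ} (I : Set (Finset (Fin k))) : Prop :=
  (∀ e ∈ I, 2 ≤ e.card) ∧ IsUpperSet I

/-- `I`-satedness of a strongly stationary law `μ`: for every strongly stationary extension `ν`
of `μ`, through a factor map `π`, the factor `π` and the `σ`-algebra `Φ_I` of `ν` are relatively
independent over `π⁻¹(Φ_I)` under the point-marginal of `ν`. -/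
def IsSated {k : ℕ} [NeZero k] {X : Type u} [MeasurableSpace X]
    (μ : Measure (Word k → X)) (I : Set (Finset (Fin k))) : Prop :=
  ∀ (Y : Type u) [MeasurableSpace Y] [StandardBorelSpace Y]
    (ν : Measure (Word k → Y)) [IsProbabilityMeasure ν] (π : Y → X),
    IsStronglyStationary ν → IsExtension ν μ π →
      RelIndep (pointMarginal ν) ((insensitiveJoin μ I).comap π)
        (MeasurableSpace.comap π inferInstance) (insensitiveJoin ν I)

/-- A law is fully sated if it is `I`-sated for every nonempty up-set `I`. -/
def IsFullySated {k : ℕ} [NeZero k] {X : Type u} [MeasurableSpace X]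
    (μ : Measure (Word k → X)) : Prop :=
  ∀ I : Set (Finset (Fin k)), I.Nonempty → IsUpSet I → IsSated μ I

/-! ### Idempotent ultrafilters on semigroups with letter substitutions -/

section UltrafilterSemigroup

open Filter

attribute [local instance] Ultrafilter.mul Ultrafilter.semigroup

variable {M : Type*} [Semigroup M]

/-! The heart is a projection formula (`exists_oblique_projection`): if A lies in Φ†_e and J is an
up-set omitting e, then on sets of Φ†_J the indicator of A integrates like a function measurable
over the join of the Φ†_u with u strictly larger than e. Given this, `splitsOver_join` proves the
theorem by removing minimal members from one up-set.

For the formula, note that modulo null sets Φ†_J sees only the coordinates outside e. So take A in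
Φ_e and i in e; one has to replace 1_A(x_i) by its projection E(1_A | ⋁ Φ_u, u ⊋ e)(x_i) against
events in the coordinates x_j, j ∉ e. Satedness would do this if each x_j were an (e ∪
{j})-insensitive function at a single point, and `exists_insensitive_extension` builds an extension
where this is so. To x_w one adjoins x_{r_j(w)}, where r_j turns every letter from e into j.
Exchanging letters of e ∪ {j} along a line does not affect r_j. On the other hand, if w contains i,
then r_i(w) and the r_j(w) are points of one line, and 1_A(x_w) = 1_A(x_{r_i(w)}) almost surely
because A is e-insensitive.

The adjoined law need not be strongly stationary, and w need not contain i. Both defects vanish on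
taking the limit of the laws of (x_{φ(w)}, x_{r_j(φ(w))}) along an ultrafilter of subspaces φ that
is invariant under composition with subspaces (`exists_stationary_limit`). Limits exist on all
measurable rectangles, because the one-dimensional marginals do not vary with φ. The ultrafilter
(`CombSubspace.exists_invariant_ultrafilter`) chooses the lines of φ successively along an
idempotent p on variable words; all letter substitutions send p to one idempotent q with p * q = q *
p = p. Filling p-random lines into a variable word then gives a p-random variable word again. -/

theorem Ultrafilter.mem_mul_of_forall_mem {A B C : Set M} (h : ∀ a ∈ A, ∀ b ∈ B, a * b ∈ C)
    {U V : Ultrafilter M} (hU : A ∈ U) (hV : B ∈ V) : C ∈ U * V := by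
  change ∀ᶠ m in ↑(U * V), m ∈ C
  rw [Ultrafilter.eventually_mul]
  filter_upwards [hU] with a ha
  filter_upwards [hV] with b hb using h a ha b hb

theorem Ultrafilter.map_mul (f : M →ₙ* M) (U V : Ultrafilter M) :
    (U * V).map f = U.map f * V.map f := by
  apply Ultrafilter.coe_injective
  refine Filter.ext' fun p => ?_
  rw [Ultrafilter.eventually_mul]
  change (∀ᶠ m in ↑(U * V), p (f m)) ↔ ∀ᶠ m in (U : Filter M), ∀ᶠ m' in (V : Filter M),
    p (f m * f m')
  rw [Ultrafilter.eventually_mul]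
  simp only [_root_.map_mul]

theorem Ultrafilter.map_eq_self_of_mem {M : Type*} {f : M → M} {A : Set M} (hf : ∀ a ∈ A, f a = a)
    {U : Ultrafilter M} (hU : A ∈ U) : U.map f = U := by
  apply Ultrafilter.coe_injective
  refine Filter.ext' fun p => ?_
  change (∀ᶠ m in (U : Filter M), p (f m)) ↔ _
  refine eventually_congr ?_
  filter_upwards [hU] with a ha
  rw [hf a ha]

/-- A subsemigroup `W` carries an idempotent ultrafilter that is minimal in the natural order on
idempotents. -/
theorem Ultrafilter.exists_minimal_idempotent {W : Set M} (hne : W.Nonempty)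
    (hW : ∀ a ∈ W, ∀ b ∈ W, a * b ∈ W) :
    ∃ q : Ultrafilter M, W ∈ q ∧ q * q = q ∧
      ∀ r : Ultrafilter M, W ∈ r → r * r = r → r * q = r → q * r = r → r = q := by
  -- The nonempty closed left ideals of the semigroup of ultrafilters on W. Compactness and Zorn
  -- give a minimal one, and any idempotent in it will do.
  let S : Set (Set (Ultrafilter M)) :=
    {N | IsClosed N ∧ N.Nonempty ∧ (∀ U ∈ N, W ∈ U) ∧
      ∀ U : Ultrafilter M, W ∈ U → ∀ V ∈ N, U * V ∈ N}
  obtain ⟨N, hN⟩ : ∃ N, Minimal (· ∈ S) N := by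
    refine zorn_superset _ fun c hcs hc => ?_
    obtain rfl | hcnemp := c.eq_empty_or_nonempty
    · obtain ⟨a, ha⟩ := hne
      exact ⟨{U | W ∈ U}, ⟨ultrafilter_isClosed_basic W, ⟨pure a, ha⟩, fun U hU => hU,
        fun U hU V hV => mem_mul_of_forall_mem hW hU hV⟩, by simp⟩
    refine ⟨⋂₀ c, ⟨isClosed_sInter fun t ht => (hcs ht).1, ?_, ?_, fun U hU V hV => ?_⟩,
      fun s hs => Set.sInter_subset_of_mem hs⟩
    · convert!
        @IsCompact.nonempty_iInter_of_directed_nonempty_isCompact_isClosed _ _ _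
          hcnemp.coe_sort ((↑) : c → Set (Ultrafilter M)) ?_ ?_ ?_ ?_
      · exact Set.sInter_eq_iInter
      · exact DirectedOn.directed_val (IsChain.directedOn hc.symm)
      exacts [fun i => (hcs i.prop).2.1, fun i => (hcs i.prop).1.isCompact,
        fun i => (hcs i.prop).1]
    · obtain ⟨t, ht⟩ := hcnemp
      exact fun U hU => (hcs ht).2.2.1 U (hU t ht)
    · exact fun t ht => (hcs ht).2.2.2 U hU V (hV t ht)
  obtain ⟨hcl, hNne, hNW, hNmul⟩ := hN.prop
  obtain ⟨q, hqN, hqq⟩ := exists_idempotent_in_compact_subsemigroup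
    Ultrafilter.continuous_mul_left N hNne hcl.isCompact
    fun x hx y hy => hNmul x (hNW x hx) y hy
  refine ⟨q, hNW q hqN, hqq, fun r hr hrr hrq hqr => ?_⟩
  have hrN : r ∈ N := hrq ▸ hNmul r hr q hqN
  -- N * r is a closed left ideal inside N, so it is all of N. Thus q = s * r for some s, whence q *
  -- r = q, while q * r = r by assumption.
  have himg : (· * r) '' N = N := by
    refine hN.eq_of_subset ⟨(Ultrafilter.continuous_mul_left r).isClosedMap _ hcl,
      hNne.image _, ?_, ?_⟩ ?_
    · rintro _ ⟨U, hU, rfl⟩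
      exact mem_mul_of_forall_mem hW (hNW U hU) hr
    · rintro U hU _ ⟨V, hV, rfl⟩
      exact ⟨U * V, hNmul U hU V hV, mul_assoc _ _ _⟩
    · rintro _ ⟨U, hU, rfl⟩
      exact hNmul U (hNW U hU) r hrN
  obtain ⟨s, -, hs⟩ : q ∈ (· * r) '' N := by rw [himg]; exact hqN
  dsimp only at hs
  rw [← hqr, ← hs, mul_assoc, hrr]

/-- If `V` absorbs a subsemigroup `W` and the retractions `h i` onto `W` map `V` into `W`, then
there is an idempotent ultrafilter on `V` that all `h i` map to the same ultrafilter `q`, and that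
absorbs `q`. -/
theorem Ultrafilter.exists_idempotent_map_eq {ι : Type*} {W V : Set M} (hWne : W.Nonempty)
    (hVne : V.Nonempty)
    (hWW : ∀ a ∈ W, ∀ b ∈ W, a * b ∈ W) (hVV : ∀ a ∈ V, ∀ b ∈ V, a * b ∈ V)
    (hVW : ∀ a ∈ V, ∀ b ∈ W, a * b ∈ V) (hWV : ∀ a ∈ W, ∀ b ∈ V, a * b ∈ V)
    (h : ι → M →ₙ* M) (hhV : ∀ i, ∀ a ∈ V, h i a ∈ W) (hhW : ∀ i, ∀ a ∈ W, h i a = a) :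
    ∃ p q : Ultrafilter M, V ∈ p ∧ p * p = p ∧ p * q = p ∧ q * p = p ∧ q * q = q ∧
      ∀ i, p.map (h i) = q := by
  obtain ⟨q, hqW, hqq, hmin⟩ := Ultrafilter.exists_minimal_idempotent hWne hWW
  obtain ⟨a, ha⟩ := hVne
  -- The products U * q with U on V form a compact subsemigroup. An idempotent x in it absorbs q on
  -- the right, and q * x then absorbs q on both sides.
  have hsub : ∀ x ∈ (· * q) '' {U : Ultrafilter M | V ∈ U},
      ∀ y ∈ (· * q) '' {U : Ultrafilter M | V ∈ U},
        x * y ∈ (· * q) '' {U : Ultrafilter M | V ∈ U} := by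
    rintro _ ⟨U, hU, rfl⟩ _ ⟨U', hU', rfl⟩
    have hU1 : V ∈ U * q := mem_mul_of_forall_mem hVW hU hqW
    have hU2 : V ∈ U * q * U' := mem_mul_of_forall_mem hVV hU1 hU'
    exact ⟨U * q * U', hU2, mul_assoc _ _ _⟩
  have hcpt : IsCompact ((· * q) '' {U : Ultrafilter M | V ∈ U}) :=
    (ultrafilter_isClosed_basic V).isCompact.image (Ultrafilter.continuous_mul_left q)
  have hne : ((· * q) '' {U : Ultrafilter M | V ∈ U}).Nonempty := ⟨_, pure a, ha, rfl⟩
  obtain ⟨x, ⟨p, hp, rfl⟩, hpp⟩ := exists_idempotent_in_compact_subsemigroup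
    Ultrafilter.continuous_mul_left _ hne hcpt hsub
  obtain ⟨x, hx⟩ : ∃ x, x = p * q := ⟨_, rfl⟩
  have hxV : V ∈ x := hx ▸ mem_mul_of_forall_mem hVW hp hqW
  have hxx : x * x = x := hx ▸ hpp
  have hxq : x * q = x := by rw [hx, mul_assoc, hqq]
  have hV : V ∈ q * x := mem_mul_of_forall_mem hWV hqW hxV
  have h1 : q * x * (q * x) = q * x := by
    rw [← mul_assoc (q * x) q, mul_assoc q x q, hxq, mul_assoc, hxx]
  have h2 : q * x * q = q * x := by rw [mul_assoc, hxq]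
  have h3 : q * (q * x) = q * x := by rw [← mul_assoc, hqq]
  refine ⟨q * x, q, hV, h1, h2, h3, hqq, fun i => ?_⟩
  -- Since `h i` fixes q, it sends q * x to an idempotent on W that lies below q; minimality of q
  -- identifies the two.
  have hq : q.map (h i) = q := Ultrafilter.map_eq_self_of_mem (hhW i) hqW
  have hmul := Ultrafilter.map_mul (h i)
  refine hmin _ (Ultrafilter.mem_map.2 (Filter.mem_of_superset hV fun a ha => hhV i a ha)) ?_ ?_ ?_
  · rw [← hmul, h1]
  · have := hmul (q * x) q
    rwa [hq, h2, eq_comm] at this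
  · have := hmul q (q * x)
    rwa [hq, h3, eq_comm] at this

end UltrafilterSemigroup

/-! ### Composition of subspaces -/

section Composition

variable {k : ℕ}

/-- Put `o`, a letter or the variable, for the variable of a variable word. -/
def VarWord.fill (o : Option (Fin k)) (u : VarWord k) : List (Option (Fin k)) :=
  u.1.map fun c => c.or o

/-- The action of a subspace on arbitrary finite words over the alphabet with the variable. -/
def CombSubspace.expand : CombSubspace k → List (Option (Fin k)) → List (Option (Fin k))
  | _, [] => []
  | φ, o :: l => (φ 0).fill o ++ CombSubspace.expand (fun n => φ (n + 1)) l

/-- The action of a subspace on possibly empty words. -/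
def CombSubspace.mapList : CombSubspace k → List (Fin k) → List (Fin k)
  | _, [] => []
  | φ, a :: l => ((φ 0).subst a).1 ++ CombSubspace.mapList (fun n => φ (n + 1)) l

theorem CombSubspace.map_val (φ : CombSubspace k) (v : Word k) :
    (φ.map v).1 = φ.mapList v.1 := by
  obtain ⟨l, hl⟩ := v
  change (l.mapIdx fun i a => ((φ i).subst a).1).flatten = φ.mapList l
  clear hl
  induction l generalizing φ with
  | nil => rfl
  | cons a l ih =>
    rw [List.mapIdx_cons, List.flatten_cons, CombSubspace.mapList, ← ih]

theorem CombSubspace.mapList_append (φ : CombSubspace k) (l l' : List (Fin k)) :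
    φ.mapList (l ++ l') = φ.mapList l ++ CombSubspace.mapList (fun n => φ (n + l.length)) l' := by
  induction l generalizing φ with
  | nil => simp [CombSubspace.mapList]
  | cons a l ih => simp [CombSubspace.mapList, ih, add_assoc]

theorem CombSubspace.mapList_congr {φ φ' : CombSubspace k} {l : List (Fin k)}
    (h : ∀ i < l.length, φ i = φ' i) : φ.mapList l = φ'.mapList l := by
  induction l generalizing φ φ' with
  | nil => rfl
  | cons a l ih =>
    rw [CombSubspace.mapList, CombSubspace.mapList, h 0 (by simp),
      ih fun i hi => h (i + 1) (by simpa using hi)]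

theorem CombSubspace.map_expand_getD (φ : CombSubspace k) (l : List (Option (Fin k)))
    (a : Fin k) :
    (φ.expand l).map (fun o => o.getD a) = φ.mapList (l.map fun o => o.getD a) := by
  induction l generalizing φ with
  | nil => rfl
  | cons o l ih =>
    simp only [CombSubspace.expand, List.map_append, List.map_cons, CombSubspace.mapList, ih,
      VarWord.fill, VarWord.subst, List.map_map]
    congr 1
    refine List.map_congr_left fun c _ => ?_
    cases c <;> rfl

theorem CombSubspace.none_mem_expand (φ : CombSubspace k) {l : List (Option (Fin k))}
    (hl : none ∈ l) : none ∈ φ.expand l := by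
  induction l generalizing φ with
  | nil => exact absurd hl List.not_mem_nil
  | cons o l ih =>
    rw [CombSubspace.expand, List.mem_append]
    rcases List.mem_cons.1 hl with h | h
    · exact Or.inl (List.mem_map.2 ⟨none, (φ 0).2, by simp [← h]⟩)
    · exact Or.inr (ih _ h)

/-- The composition of subspaces. -/
def CombSubspace.comp : CombSubspace k → CombSubspace k → CombSubspace k
  | φ, ψ, 0 => ⟨φ.expand (ψ 0).1, φ.none_mem_expand (ψ 0).2⟩
  -- Expanding the first line of ψ uses up as many lines of φ as it has symbols, so the later lines
  -- are composed with a shifted φ.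
  | φ, ψ, n + 1 =>
    CombSubspace.comp (fun i => φ (i + (ψ 0).1.length)) (fun i => ψ (i + 1)) n

theorem CombSubspace.mapList_comp (φ ψ : CombSubspace k) (l : List (Fin k)) :
    (φ.comp ψ).mapList l = φ.mapList (ψ.mapList l) := by
  induction l generalizing φ ψ with
  | nil => rfl
  | cons a l ih =>
    have h := ih (fun i => φ (i + (ψ 0).1.length)) (fun i => ψ (i + 1))
    simp only [CombSubspace.mapList, CombSubspace.mapList_append]
    congr 1
    · exact φ.map_expand_getD _ _
    · refine Eq.trans h ?_
      simp [VarWord.subst]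

theorem CombSubspace.map_comp (φ ψ : CombSubspace k) (w : Word k) :
    (φ.comp ψ).map w = φ.map (ψ.map w) := by
  apply Subtype.ext
  rw [CombSubspace.map_val, CombSubspace.map_val, CombSubspace.map_val, CombSubspace.mapList_comp]

end Composition

/-! ### An ultrafilter on subspaces that is invariant under composition -/

section InvariantUltrafilter

open Filter

attribute [local instance] Ultrafilter.mul Ultrafilter.semigroup

variable {k : ℕ}

/-- Prepend a variable word to a subspace. -/
def CombSubspace.cons (u : VarWord k) (φ : CombSubspace k) : CombSubspace k
  | 0 => u
  | n + 1 => φ n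

/-- The distribution of the word obtained from `l` by filling in independent `p`-random variable
words. -/
def VarWord.prodUltrafilter (p : Ultrafilter (VarWord k)) :
    List (Option (Fin k)) → Ultrafilter (FreeMonoid (Option (Fin k)))
  | [] => pure 1
  | o :: l => p.map (fun u => FreeMonoid.ofList (u.fill o)) * VarWord.prodUltrafilter p l

/-- The product over u has a factor P for each variable and a factor q for each letter, where q is
the common image of P under the substitutions. As PP = Pq = qP = P and qq = q, one occurrence of the
variable collapses the product to P. -/
theorem VarWord.exists_coherent_ultrafilter [NeZero k] :
    ∃ p : Ultrafilter (VarWord k), ∀ u : VarWord k,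
      VarWord.prodUltrafilter p u.1 = p.map fun u => FreeMonoid.ofList u.1 := by
  obtain ⟨P, q, hV, hPP, hPq, hqP, hqq, hsub⟩ := Ultrafilter.exists_idempotent_map_eq
    (M := FreeMonoid (Option (Fin k)))
    (W := {l | none ∉ l.toList ∧ l.toList ≠ []}) (V := {l | none ∈ l.toList})
    ⟨FreeMonoid.ofList [some 0], by simp⟩ ⟨FreeMonoid.ofList [none], by simp⟩
    (by rintro a ⟨ha, ha'⟩ b ⟨hb, hb'⟩; simp_all [FreeMonoid.toList_mul])
    (by intro a ha b hb; simp_all [FreeMonoid.toList_mul])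
    (by intro a ha b hb; simp_all [FreeMonoid.toList_mul])
    (by intro a ha b hb; simp_all [FreeMonoid.toList_mul])
    (fun i : Fin k => (FreeMonoid.map fun c : Option (Fin k) => c.or (some i)).toMulHom)
    (by
      intro i a ha
      refine ⟨fun h => ?_, fun h => ?_⟩
      · obtain ⟨c, -, hc⟩ := List.mem_map.1 h
        cases c <;> simp at hc
      · have h' : a.toList = [] := List.map_eq_nil_iff.1 h
        simp [h'] at ha)
    (by
      rintro i a ⟨ha, -⟩
      apply FreeMonoid.toList.injective
      change a.toList.map _ = a.toList
      conv_rhs => rw [← List.map_id a.toList]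
      refine List.map_congr_left fun c hc => ?_
      cases c with
      | none => exact absurd hc ha
      | some c => rfl)
  let val : VarWord k → FreeMonoid (Option (Fin k)) := fun u => FreeMonoid.ofList u.1
  have hval : Function.Injective val := fun u v h => Subtype.ext h
  have hrange : Set.range val ∈ P := by
    refine Filter.mem_of_superset hV fun l hl => ⟨⟨l.toList, hl⟩, rfl⟩
  let p : Ultrafilter (VarWord k) := P.comap hval hrange
  have hp : p.map val = P := by
    apply Ultrafilter.coe_injective
    rw [Ultrafilter.coe_map, Ultrafilter.coe_comap, Filter.map_comap_of_mem hrange]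
  have hnone : p.map (fun u => FreeMonoid.ofList (u.fill none)) = P := by
    rw [← hp]
    congr 1
    funext u
    simp [VarWord.fill, val]
  have hsome : ∀ i : Fin k, p.map (fun u => FreeMonoid.ofList (u.fill (some i))) = q := by
    intro i
    rw [← hsub i, ← hp, Ultrafilter.map_map]
    rfl
  have hone : ∀ U : Ultrafilter (FreeMonoid (Option (Fin k))), U * pure 1 = U := by
    intro U
    apply Ultrafilter.coe_injective
    refine Filter.ext' fun r => ?_
    rw [Ultrafilter.eventually_mul]
    simp
  have hq : ∀ l : List (Option (Fin k)), none ∉ l → l ≠ [] → VarWord.prodUltrafilter p l = q := by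
    intro l
    induction l with
    | nil => simp
    | cons o l ih =>
      intro h _
      cases o with
      | none => simp at h
      | some i =>
        rw [VarWord.prodUltrafilter, hsome]
        rcases eq_or_ne l [] with rfl | hl
        · exact hone q
        · rw [ih (fun h' => h (List.mem_cons_of_mem _ h')) hl, hqq]
  have hPl : ∀ l : List (Option (Fin k)), none ∈ l → VarWord.prodUltrafilter p l = P := by
    intro l
    induction l with
    | nil => simp
    | cons o l ih =>
      intro h
      rw [VarWord.prodUltrafilter]
      by_cases hl : none ∈ l
      · rw [ih hl]
        cases o with
        | none => rw [hnone, hPP]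
        | some i => rw [hsome, hqP]
      · obtain rfl : none = o := by simpa [hl] using h
        rw [hnone]
        rcases eq_or_ne l [] with rfl | hl'
        · exact hone P
        · rw [hq l hl hl', hPq]
  exact ⟨p, fun u => (hPl u.1 u.2).trans hp.symm⟩

/-- The distribution of a sequence of variable words whose first `n` terms are chosen
successively along `p`. -/
def CombSubspace.seqUltrafilter (p : Ultrafilter (VarWord k)) : ℕ → Ultrafilter (CombSubspace k)
  -- The lines from index n on are a dummy value, harmless for predicates that depend on the first n
  -- lines only.
  | 0 => pure fun _ => ⟨[none], by simp⟩
  | n + 1 => p.bind fun u => (CombSubspace.seqUltrafilter p n).map (CombSubspace.cons u)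

/-- The predicate `R` depends only on the first `m` lines of a subspace. -/
def CombSubspace.DependsOnFirst (m : ℕ) (R : CombSubspace k → Prop) : Prop :=
  ∀ φ φ' : CombSubspace k, (∀ i < m, φ i = φ' i) → (R φ ↔ R φ')

theorem CombSubspace.DependsOnFirst.cons {m : ℕ} {R : CombSubspace k → Prop}
    (hR : CombSubspace.DependsOnFirst (m + 1) R) (u : VarWord k) :
    CombSubspace.DependsOnFirst m fun φ => R (CombSubspace.cons u φ) := by
  intro φ φ' h
  refine hR _ _ fun i hi => ?_
  cases i with
  | zero => rfl
  | succ i => exact h i (by lia)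

theorem CombSubspace.eventually_seqUltrafilter_succ (p : Ultrafilter (VarWord k)) (n : ℕ)
    (R : CombSubspace k → Prop) :
    (∀ᶠ φ in (CombSubspace.seqUltrafilter p (n + 1) : Filter (CombSubspace k)), R φ) ↔
      ∀ᶠ u in (p : Filter (VarWord k)),
        ∀ᶠ φ in (CombSubspace.seqUltrafilter p n : Filter (CombSubspace k)),
          R (CombSubspace.cons u φ) :=
  Iff.rfl

theorem CombSubspace.eventually_seqUltrafilter_congr (p : Ultrafilter (VarWord k)) {m n : ℕ}
    (hmn : m ≤ n) {R : CombSubspace k → Prop} (hR : CombSubspace.DependsOnFirst m R) :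
    (∀ᶠ φ in (CombSubspace.seqUltrafilter p n : Filter (CombSubspace k)), R φ) ↔
      ∀ᶠ φ in (CombSubspace.seqUltrafilter p m : Filter (CombSubspace k)), R φ := by
  induction m generalizing n R with
  | zero =>
    have h : ∀ φ, R φ ↔ R fun _ => ⟨[none], by simp⟩ := fun φ => hR _ _ (by simp)
    simp only [h, eventually_const]
  | succ m ih =>
    obtain ⟨n, rfl⟩ : ∃ n', n = n' + 1 := ⟨n - 1, by lia⟩
    rw [eventually_seqUltrafilter_succ, eventually_seqUltrafilter_succ]
    exact eventually_congr (Eventually.of_forall fun u => ih (by lia) (hR.cons u))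

/-- Each symbol of l uses up one p-random line, so the expansion has the product distribution; the
lines left over are chosen afterwards and form a fresh p-random sequence. -/
theorem CombSubspace.eventually_seqUltrafilter_expand (p : Ultrafilter (VarWord k))
    (l : List (Option (Fin k))) (n : ℕ)
    (R : FreeMonoid (Option (Fin k)) → CombSubspace k → Prop) :
    (∀ᶠ φ in (CombSubspace.seqUltrafilter p (n + l.length) : Filter (CombSubspace k)),
      R (FreeMonoid.ofList (φ.expand l)) fun i => φ (i + l.length)) ↔
      ∀ᶠ v in (VarWord.prodUltrafilter p l : Filter (FreeMonoid (Option (Fin k)))),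
        ∀ᶠ φ in (CombSubspace.seqUltrafilter p n : Filter (CombSubspace k)), R v φ := by
  induction l generalizing R with
  | nil => exact Iff.rfl
  | cons o l ih =>
    rw [List.length_cons, ← add_assoc, eventually_seqUltrafilter_succ, VarWord.prodUltrafilter,
      Ultrafilter.eventually_mul]
    refine Iff.trans ?_ (eventually_map (m := fun u : VarWord k => FreeMonoid.ofList (u.fill o))
      (f := (p : Filter (VarWord k)))).symm
    refine eventually_congr (Eventually.of_forall fun u => ?_)
    exact ih fun v φ => R (FreeMonoid.ofList (u.fill o) * v) φ

/-- By coherence the first line of the composition is again p-random, and the others come from fresh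
lines of φ, which allows induction. The threshold N is the total length of the first m lines of ψ.
-/
theorem CombSubspace.eventually_seqUltrafilter_comp {p : Ultrafilter (VarWord k)}
    (hp : ∀ u : VarWord k,
      VarWord.prodUltrafilter p u.1 = p.map fun u => FreeMonoid.ofList u.1)
    (m : ℕ) (ψ : CombSubspace k) :
    ∃ N, ∀ n ≥ N, ∀ R : CombSubspace k → Prop, CombSubspace.DependsOnFirst m R →
      ((∀ᶠ φ in (CombSubspace.seqUltrafilter p n : Filter (CombSubspace k)), R (φ.comp ψ)) ↔
        ∀ᶠ φ in (CombSubspace.seqUltrafilter p m : Filter (CombSubspace k)), R φ) := by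
  induction m generalizing ψ with
  | zero =>
    refine ⟨0, fun n _ R hR => ?_⟩
    have h : ∀ φ, R φ ↔ R fun _ => ⟨[none], by simp⟩ := fun φ => hR _ _ (by simp)
    simp only [h, eventually_const]
  | succ m ih =>
    obtain ⟨N, hN⟩ := ih fun i => ψ (i + 1)
    refine ⟨N + (ψ 0).1.length, fun n hn R hR => ?_⟩
    obtain ⟨n, rfl⟩ : ∃ n', n = n' + (ψ 0).1.length := ⟨n - (ψ 0).1.length, by lia⟩
    have h := eventually_seqUltrafilter_expand p (ψ 0).1 n fun v φ =>
      ∃ hv : none ∈ v.toList,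
        R (CombSubspace.cons ⟨v.toList, hv⟩ (φ.comp fun i => ψ (i + 1)))
    rw [hp] at h
    rw [eventually_seqUltrafilter_succ]
    refine Iff.trans (eventually_congr (Eventually.of_forall fun φ => ?_)) (h.trans ?_)
    · have hcons : φ.comp ψ = CombSubspace.cons ⟨φ.expand (ψ 0).1, φ.none_mem_expand (ψ 0).2⟩
          (CombSubspace.comp (fun i => φ (i + (ψ 0).1.length)) fun i => ψ (i + 1)) := by
        funext i
        cases i <;> rfl
      rw [hcons]
      exact ⟨fun h => ⟨_, h⟩, fun ⟨_, h⟩ => h⟩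
    · refine Iff.trans (eventually_map (m := fun u : VarWord k => FreeMonoid.ofList u.1)
        (f := (p : Filter (VarWord k)))) ?_
      refine eventually_congr (Eventually.of_forall fun u => ?_)
      rw [← hN n (by lia) _ (hR.cons u)]
      exact eventually_congr (Eventually.of_forall fun φ => ⟨fun ⟨_, h⟩ => h, fun h => ⟨u.2, h⟩⟩)

/-- There is an ultrafilter on subspaces that, as far as finitely many lines are concerned, is
invariant under composition with every subspace. -/
theorem CombSubspace.exists_invariant_ultrafilter (k : ℕ) [NeZero k] :
    ∃ V : Ultrafilter (CombSubspace k), ∀ (ψ : CombSubspace k) (m : ℕ)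
      (R : CombSubspace k → Prop), CombSubspace.DependsOnFirst m R →
      ((∀ᶠ φ in (V : Filter (CombSubspace k)), R (φ.comp ψ)) ↔
        ∀ᶠ φ in (V : Filter (CombSubspace k)), R φ) := by
  obtain ⟨p, hp⟩ := VarWord.exists_coherent_ultrafilter (k := k)
  have hbind : ∀ R : CombSubspace k → Prop,
      (∀ᶠ φ in ((hyperfilter ℕ).bind (CombSubspace.seqUltrafilter p) :
        Filter (CombSubspace k)), R φ) ↔ ∀ᶠ n in (hyperfilter ℕ : Filter ℕ),
          ∀ᶠ φ in (CombSubspace.seqUltrafilter p n : Filter (CombSubspace k)), R φ :=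
    fun R => Iff.rfl
  -- No fixed length n passes the threshold for every ψ and m, so n tends to infinity along a
  -- nonprincipal ultrafilter.
  refine ⟨(hyperfilter ℕ).bind (CombSubspace.seqUltrafilter p), fun ψ m R hR => ?_⟩
  obtain ⟨N, hN⟩ := CombSubspace.eventually_seqUltrafilter_comp hp m ψ
  rw [hbind, hbind]
  refine eventually_congr ?_
  filter_upwards [Nat.hyperfilter_le_atTop (eventually_ge_atTop (max m N))] with n hn
  rw [hN n (le_of_max_le_right hn) R hR,
    CombSubspace.eventually_seqUltrafilter_congr p (le_of_max_le_left hn) hR]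

end InvariantUltrafilter

/-! ### Limits of laws with constant one-dimensional marginals -/

section LimitLaw

open Filter Topology

theorem hasSum_measureReal_iUnion {Ω : Type*} [MeasurableSpace Ω] (μ : Measure Ω)
    [IsFiniteMeasure μ] {D : ℕ → Set Ω} (hd : Pairwise (Function.onFun Disjoint D))
    (hD : ∀ i, MeasurableSet (D i)) : HasSum (fun i => μ.real (D i)) (μ.real (⋃ i, D i)) := by
  have h := measure_iUnion hd hD (μ := μ)
  have hne : ∑' i, μ (D i) ≠ ⊤ := h ▸ measure_ne_top μ _
  have hs := ENNReal.summable_toReal hne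
  have h2 : μ.real (⋃ i, D i) = ∑' i, μ.real (D i) := by
    rw [measureReal_def, h, ENNReal.tsum_toReal_eq fun i => measure_ne_top μ _]
    rfl
  exact h2 ▸ hs.hasSum

/-- For disjoint unions, limit and sum are exchanged by dominated convergence: the fixed law m of f
supplies the summable bound m(D_i), uniform in n. This is how convergence passes from a π-system to
the σ-algebra it generates. -/
theorem tendsto_measureReal_inter_preimage {ι Ω C : Type*} [MeasurableSpace Ω]
    [mC : MeasurableSpace C] {l : Filter ι} {P : ι → Measure Ω} [∀ n, IsProbabilityMeasure (P n)]
    {ν : Measure Ω} [IsProbabilityMeasure ν] {f : Ω → C} (hf : Measurable f) {m : Measure C}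
    [IsFiniteMeasure m] (hP : ∀ n, (P n).map f = m) {S : Set (Set C)}
    (hS : mC = MeasurableSpace.generateFrom S) (hpi : IsPiSystem S) {R : Set Ω}
    (hR : MeasurableSet R) (hR' : Tendsto (fun n => (P n).real R) l (𝓝 (ν.real R)))
    (h : ∀ D ∈ S, Tendsto (fun n => (P n).real (R ∩ f ⁻¹' D)) l (𝓝 (ν.real (R ∩ f ⁻¹' D))))
    {D : Set C} (hD : MeasurableSet D) :
    Tendsto (fun n => (P n).real (R ∩ f ⁻¹' D)) l (𝓝 (ν.real (R ∩ f ⁻¹' D))) := by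
  induction D, hD using MeasurableSpace.induction_on_inter hS hpi with
  | empty => simpa using tendsto_const_nhds
  | basic D hD => exact h D hD
  | compl D hD ih =>
    have key : ∀ (Q : Measure Ω) [IsProbabilityMeasure Q],
        Q.real (R ∩ f ⁻¹' Dᶜ) = Q.real R - Q.real (R ∩ f ⁻¹' D) := by
      intro Q _
      rw [← measureReal_inter_add_sdiff (μ := Q) (s := R) (hf hD), Set.preimage_compl, Set.sdiff_eq]
      ring
    simp only [key]
    exact hR'.sub ih
  | iUnion D hd hD ih =>
    have key : ∀ (Q : Measure Ω) [IsProbabilityMeasure Q],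
        HasSum (fun i => Q.real (R ∩ f ⁻¹' D i)) (Q.real (R ∩ f ⁻¹' ⋃ i, D i)) := by
      intro Q _
      rw [Set.preimage_iUnion, Set.inter_iUnion]
      refine hasSum_measureReal_iUnion Q (fun i j hij => ?_) fun i => hR.inter (hf (hD i))
      exact ((hd hij).preimage f).mono Set.inter_subset_right Set.inter_subset_right
    rw [← (key ν).tsum_eq]
    simp only [← (key (P _)).tsum_eq]
    refine tendsto_tsum_of_dominated_convergence (bound := fun i => m.real (D i))
      (hasSum_measureReal_iUnion m hd hD).summable ih (Eventually.of_forall fun n i => ?_)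
    rw [Real.norm_of_nonneg measureReal_nonneg, ← hP n, map_measureReal_apply hf (hD i)]
    exact measureReal_mono Set.inter_subset_right

theorem borel_cantor_eq_generateFrom_isClopen :
    (inferInstance : MeasurableSpace (ℕ → Bool)) =
      MeasurableSpace.generateFrom {D : Set (ℕ → Bool) | IsClopen D} := by
  rw [← (isTopologicalBasis_isClopen (X := ℕ → Bool)).borel_eq_generateFrom]
  exact BorelSpace.measurable_eq

theorem isPiSystem_isClopen {C : Type*} [TopologicalSpace C] :
    IsPiSystem {D : Set C | IsClopen D} :=
  fun _ hA _ hB _ => hA.inter hB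

theorem measurableSet_forall_mem_finset {T C : Type*} [MeasurableSpace C] (s : Finset T)
    {A : T → Set C} (hA : ∀ t, MeasurableSet (A t)) :
    MeasurableSet {y : T → C | ∀ t ∈ s, y t ∈ A t} := by
  have : {y : T → C | ∀ t ∈ s, y t ∈ A t} = ⋂ t ∈ s, (fun y => y t) ⁻¹' A t := by
    ext y; simp
  rw [this]
  exact Finset.measurableSet_biInter _ fun t _ => measurable_pi_apply t (hA t)

/-- Compactness gives a weak limit, hence convergence on clopen sets. The fixed marginals then allow
measurable conditions on one coordinate after another. -/
theorem exists_limit_law_cantor {ι T : Type*} [Countable T] (V : Ultrafilter ι)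
    (P : ι → Measure (T → ℕ → Bool)) [∀ n, IsProbabilityMeasure (P n)]
    (m : T → Measure (ℕ → Bool)) [∀ t, IsFiniteMeasure (m t)]
    (hP : ∀ n t, (P n).map (fun y => y t) = m t) :
    ∃ ν : Measure (T → ℕ → Bool), IsProbabilityMeasure ν ∧
      ∀ (s : Finset T) (A : T → Set (ℕ → Bool)), (∀ t, MeasurableSet (A t)) →
        Tendsto (fun n => (P n).real {y | ∀ t ∈ s, y t ∈ A t}) V
          (𝓝 (ν.real {y | ∀ t ∈ s, y t ∈ A t})) := by
  let P' : ι → ProbabilityMeasure (T → ℕ → Bool) := fun n => ⟨P n, inferInstance⟩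
  let ν : ProbabilityMeasure (T → ℕ → Bool) := (V.map P').lim
  have hlim : Tendsto P' V (𝓝 ν) := (V.map P').le_nhds_lim
  have hclopen : ∀ K : Set (T → ℕ → Bool), IsClopen K →
      Tendsto (fun n => (P n).real K) V (𝓝 ((ν : Measure (T → ℕ → Bool)).real K)) := by
    intro K hK
    have h := ProbabilityMeasure.tendsto_measure_of_isClopen_of_tendsto hlim hK
    exact (NNReal.continuous_coe.tendsto _).comp h
  refine ⟨ν, inferInstance, fun s A hA => ?_⟩
  -- The clopen set K is carried through the induction to absorb a clopen condition on the next
  -- coordinate.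
  have key : ∀ K : Set (T → ℕ → Bool), IsClopen K →
      Tendsto (fun n => (P n).real (K ∩ {y | ∀ t ∈ s, y t ∈ A t})) V
        (𝓝 ((ν : Measure (T → ℕ → Bool)).real (K ∩ {y | ∀ t ∈ s, y t ∈ A t}))) := by
    classical
    induction s using Finset.induction_on with
    | empty =>
      intro K hK
      simpa using hclopen K hK
    | insert t s ht ih =>
      intro K hK
      have e : K ∩ {y : T → ℕ → Bool | ∀ t' ∈ insert t s, y t' ∈ A t'} =
          (K ∩ {y | ∀ t ∈ s, y t ∈ A t}) ∩ (fun y => y t) ⁻¹' A t := by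
        ext y
        simp only [Finset.forall_mem_insert, Set.mem_inter_iff, Set.mem_ofPred_eq,
          Set.mem_preimage]
        tauto
      rw [e]
      refine tendsto_measureReal_inter_preimage (measurable_pi_apply t) (fun n => hP n t)
        borel_cantor_eq_generateFrom_isClopen isPiSystem_isClopen ?_ (ih K hK) ?_ (hA t)
      · exact hK.isClosed.measurableSet.inter (measurableSet_forall_mem_finset s hA)
      · intro D hD
        have h := ih (K ∩ (fun y => y t) ⁻¹' D)
          (hK.inter (hD.preimage (continuous_apply t)))
        rwa [Set.inter_right_comm] at h
  simpa using key Set.univ isClopen_univ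

/-- A family of laws on `X ^ T` with constant one-dimensional marginals has a limit along every
ultrafilter, in the sense of convergence on all measurable rectangles. -/
theorem exists_limit_law {ι T X : Type*} [Countable T] [MeasurableSpace X]
    [StandardBorelSpace X] (V : Ultrafilter ι) (P : ι → Measure (T → X))
    [∀ n, IsProbabilityMeasure (P n)] (m : T → Measure X) [∀ t, IsFiniteMeasure (m t)]
    (hP : ∀ n t, (P n).map (fun y => y t) = m t) :
    ∃ ν : Measure (T → X), IsProbabilityMeasure ν ∧
      ∀ (s : Finset T) (A : T → Set X), (∀ t, MeasurableSet (A t)) →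
        Tendsto (fun n => (P n).real {y | ∀ t ∈ s, y t ∈ A t}) V
          (𝓝 (ν.real {y | ∀ t ∈ s, y t ∈ A t})) := by
  obtain ⟨n₀⟩ : Nonempty ι := V.neBot.nonempty
  have hXT : Nonempty (T → X) := nonempty_of_isProbabilityMeasure (P n₀)
  rcases isEmpty_or_nonempty T with hT | ⟨⟨t₀⟩⟩
  · refine ⟨P n₀, inferInstance, fun s A _ => ?_⟩
    simp
  have hX : Nonempty X := hXT.map fun y => y t₀
  -- A Borel embedding into Cantor space with measurable left inverse g reduces the claim to the
  -- compact case.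
  let c : X → ℕ → Bool := MeasurableSpace.mapNatBool X
  have hc : Measurable c := MeasurableSpace.measurable_mapNatBool X
  obtain ⟨g, hg, hgc⟩ := (hc.measurableEmbedding
    (MeasurableSpace.injective_mapNatBool X)).exists_measurable_extend measurable_id fun _ => hX
  have hcT : Measurable fun (y : T → X) t => c (y t) := by fun_prop
  have hgT : Measurable fun (y : T → ℕ → Bool) t => g (y t) := by fun_prop
  have : ∀ n, IsProbabilityMeasure ((P n).map fun (y : T → X) t => c (y t)) := fun n =>
    Measure.isProbabilityMeasure_map hcT.aemeasurable
  obtain ⟨ν, hν, hlim⟩ := exists_limit_law_cantor V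
    (fun n => (P n).map fun (y : T → X) t => c (y t)) (fun t => (m t).map c) (by
      intro n t
      rw [← hP n t, Measure.map_map (measurable_pi_apply t) hcT,
        Measure.map_map hc (measurable_pi_apply t)]
      rfl)
  refine ⟨ν.map fun (y : T → ℕ → Bool) t => g (y t),
    Measure.isProbabilityMeasure_map hgT.aemeasurable, fun s A hA => ?_⟩
  have h := hlim s (fun t => g ⁻¹' A t) fun t => hg (hA t)
  rw [map_measureReal_apply hgT (measurableSet_forall_mem_finset s hA)]
  refine h.congr fun n => ?_
  rw [map_measureReal_apply hcT (measurableSet_forall_mem_finset s fun t => hg (hA t))]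
  congr 1
  ext y
  simp only [Set.mem_preimage, Set.mem_ofPred_eq]
  have : ∀ t, g (c (y t)) = y t := fun t => congrFun hgc (y t)
  simp only [this]

end LimitLaw

/-! ### Strongly stationary limits -/

section StationaryLimit

open Filter Topology

theorem ext_of_measureReal_rectangles {T X : Type*} [MeasurableSpace X] {P Q : Measure (T → X)}
    [IsFiniteMeasure P] [IsFiniteMeasure Q]
    (h : ∀ (s : Finset T) (A : T → Set X), (∀ t, MeasurableSet (A t)) →
      P.real {y | ∀ t ∈ s, y t ∈ A t} = Q.real {y | ∀ t ∈ s, y t ∈ A t}) : P = Q := by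
  refine ext_of_generate_finite _
    (generateFrom_squareCylinders (α := fun _ : T => X)).symm
    (isPiSystem_squareCylinders (fun _ => MeasurableSpace.isPiSystem_measurableSet)
      fun _ => MeasurableSet.univ) ?_ ?_
  swap
  · simpa [measureReal_eq_measureReal_iff] using h ∅ (fun _ => Set.univ) fun _ => MeasurableSet.univ
  rintro _ ⟨s, A, hA, rfl⟩
  have hA' : ∀ t, MeasurableSet (A t) := fun t => hA t (Set.mem_univ t)
  have h' := h s A hA'
  rw [measureReal_eq_measureReal_iff] at h'
  exact h'

variable {k : ℕ} {X : Type u} [MeasurableSpace X]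

theorem CombSubspace.map_congr {φ φ' : CombSubspace k} {w : Word k}
    (h : ∀ i < w.1.length, φ i = φ' i) : φ.map w = φ'.map w := by
  apply Subtype.ext
  rw [CombSubspace.map_val, CombSubspace.map_val, CombSubspace.mapList_congr h]

/-- For arbitrary maps `ρ s` on words, the laws of `(x_{ρ s (φ(w))})_{w, s}` have a strongly
stationary limit as `φ` goes along some ultrafilter of subspaces. -/
theorem exists_stationary_limit [NeZero k] [StandardBorelSpace X] {μ : Measure (Word k → X)}
    [IsProbabilityMeasure μ] (hss : IsStronglyStationary μ) {S : Type} [Countable S]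
    (ρ : S → Word k → Word k) :
    ∃ (V : Ultrafilter (CombSubspace k)) (ν : Measure (Word k → S → X)),
      IsProbabilityMeasure ν ∧ IsStronglyStationary ν ∧
      ∀ (κ : Type) [Finite κ] (w : κ → Word k) (s : κ → S) (A : κ → Set X),
        (∀ c, MeasurableSet (A c)) →
        Tendsto (fun φ : CombSubspace k => μ.real {ω | ∀ c, ω (ρ (s c) (φ.map (w c))) ∈ A c}) V
          (𝓝 (ν.real {y | ∀ c, y (w c) (s c) ∈ A c})) := by
  obtain ⟨V, hV⟩ := CombSubspace.exists_invariant_ultrafilter k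
  have hmeas : ∀ φ : CombSubspace k,
      Measurable fun (ω : Word k → X) (t : Word k × S) => ω (ρ t.2 (φ.map t.1)) := by fun_prop
  have : ∀ φ : CombSubspace k, IsProbabilityMeasure
      (μ.map fun (ω : Word k → X) (t : Word k × S) => ω (ρ t.2 (φ.map t.1))) := fun φ =>
    Measure.isProbabilityMeasure_map (hmeas φ).aemeasurable
  have : IsProbabilityMeasure (pointMarginal μ) :=
    Measure.isProbabilityMeasure_map (measurable_pi_apply _).aemeasurable
  obtain ⟨N, hN, hlim⟩ := exists_limit_law V
    (fun φ : CombSubspace k => μ.map fun (ω : Word k → X) (t : Word k × S) =>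
      ω (ρ t.2 (φ.map t.1))) (fun _ => pointMarginal μ) (by
      intro φ t
      rw [Measure.map_map (measurable_pi_apply t) (hmeas φ)]
      exact map_eval_eq_pointMarginal hss _)
  have hcyl : ∀ (κ : Type) [Finite κ] (t : κ → Word k × S) (A : κ → Set X),
      (∀ c, MeasurableSet (A c)) →
      Tendsto (fun φ : CombSubspace k => μ.real {ω | ∀ c, ω (ρ (t c).2 (φ.map (t c).1)) ∈ A c}) V
        (𝓝 (N.real {y | ∀ c, y (t c) ∈ A c})) := by
    classical
    intro κ _ t A hA
    have := Fintype.ofFinite κ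
    -- Since t may repeat a coordinate, the conditions imposed on each coordinate are intersected.
    have hA' : ∀ t', MeasurableSet {x | ∀ c, t c = t' → x ∈ A c} := by
      intro t'
      have : {x | ∀ c, t c = t' → x ∈ A c} = ⋂ c, ⋂ (_ : t c = t'), A c := by ext; simp
      rw [this]
      exact MeasurableSet.iInter fun c => MeasurableSet.iInter fun _ => hA c
    have h := hlim (Finset.univ.image t) (fun t' => {x | ∀ c, t c = t' → x ∈ A c}) hA'
    have e : ∀ y : Word k × S → X, (∀ t' ∈ Finset.univ.image t,
        y t' ∈ {x | ∀ c, t c = t' → x ∈ A c}) ↔ ∀ c, y (t c) ∈ A c := by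
      intro y
      simp only [Finset.mem_image, Finset.mem_univ, true_and, forall_exists_index,
        forall_apply_eq_imp_iff, Set.mem_ofPred_eq]
      exact ⟨fun h c => h c c rfl, fun h c c' hc => hc ▸ h c'⟩
    refine (h.congr fun φ => ?_).trans (by simp only [e]; exact le_rfl)
    rw [map_measureReal_apply (hmeas φ) (measurableSet_forall_mem_finset _ hA')]
    congr 1
    ext ω
    exact e fun t' => ω (ρ t'.2 (φ.map t'.1))
  have hcur : Measurable fun (y : Word k × S → X) w s => y (w, s) := by fun_prop
  refine ⟨V, N.map fun y w s => y (w, s), Measure.isProbabilityMeasure_map hcur.aemeasurable,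
    fun ψ => ?_, fun κ _ w s A hA => ?_⟩
  · have hg : Measurable fun (y : Word k × S → X) (t : Word k × S) => y (ψ.map t.1, t.2) := by
      fun_prop
    have hgp : IsProbabilityMeasure
        (N.map fun (y : Word k × S → X) (t : Word k × S) => y (ψ.map t.1, t.2)) :=
      Measure.isProbabilityMeasure_map hg.aemeasurable
    have hinv : N.map (fun (y : Word k × S → X) (t : Word k × S) => y (ψ.map t.1, t.2)) = N := by
      refine ext_of_measureReal_rectangles fun s A hA => ?_
      rw [map_measureReal_apply hg (measurableSet_forall_mem_finset s hA)]
      have h1 := hcyl (Fin s.card) (fun c => (ψ.map (s.equivFin.symm c).1.1,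
        (s.equivFin.symm c).1.2)) (fun c => A (s.equivFin.symm c)) fun c => hA _
      have h2 := hcyl (Fin s.card) (fun c => (s.equivFin.symm c).1)
        (fun c => A (s.equivFin.symm c)) fun c => hA _
      have e : ∀ y : Word k × S → X, (∀ t ∈ s, y t ∈ A t) ↔
          ∀ c, y (s.equivFin.symm c) ∈ A (s.equivFin.symm c) := fun y =>
        ⟨fun h c => h _ (s.equivFin.symm c).2, fun h t ht => by
          simpa using h (s.equivFin ⟨t, ht⟩)⟩
      -- A rectangle involves finitely many words, whose images depend on the first m lines of φ
      -- only. This is what makes the invariance of V applicable.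
      obtain ⟨m, hm⟩ : ∃ m, ∀ t ∈ s, t.1.1.length ≤ m :=
        ⟨s.sup fun t => t.1.1.length, fun t ht => Finset.le_sup (f := fun t => t.1.1.length) ht⟩
      have h3 : Tendsto (fun φ : CombSubspace k => μ.real {ω | ∀ c : Fin s.card,
          ω (ρ (s.equivFin.symm c).1.2 (φ.map (ψ.map (s.equivFin.symm c).1.1))) ∈
            A (s.equivFin.symm c)}) V
          (𝓝 (N.real {y | ∀ c, y (s.equivFin.symm c).1 ∈ A (s.equivFin.symm c)})) := by
        intro U hU
        have h4 := (hV ψ m (R := fun φ => μ.real {ω | ∀ c : Fin s.card,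
          ω (ρ (s.equivFin.symm c).1.2 (φ.map (s.equivFin.symm c).1.1)) ∈
            A (s.equivFin.symm c)} ∈ U) ?_).2 (h2 hU)
        · simp only [CombSubspace.map_comp] at h4
          exact h4
        · intro φ φ' hφ
          have : ∀ c : Fin s.card, φ.map (s.equivFin.symm c).1.1 =
              φ'.map (s.equivFin.symm c).1.1 := fun c =>
            CombSubspace.map_congr fun i hi =>
              hφ i (hi.trans_le (hm _ (s.equivFin.symm c).2))
          simp only [this]
      have h5 := tendsto_nhds_unique h1 h3
      simp only [e]
      exact h5
    rw [Measure.map_map (by fun_prop) hcur]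
    conv_rhs => rw [← hinv, Measure.map_map hcur hg]
    rfl
  · have h := hcyl κ (fun c => (w c, s c)) A hA
    rw [map_measureReal_apply hcur]
    · exact h
    · have : {y : Word k → S → X | ∀ c, y (w c) (s c) ∈ A c} =
          ⋂ c, (fun y => y (w c) (s c)) ⁻¹' A c := by
        ext; simp
      rw [this]
      exact MeasurableSet.iInter fun c =>
        ((measurable_pi_apply (s c)).comp (measurable_pi_apply (w c))) (hA c)

end StationaryLimit

/-! ### Replacing letters -/

section ReplaceLetters

variable {k : ℕ}

/-- Replace all letters from `e` by the letter `j`. -/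
def Word.replaceLetters (e : Finset (Fin k)) (j : Fin k) (w : Word k) : Word k :=
  ⟨w.1.map fun a => if a ∈ e then j else a, fun h => w.2 (List.map_eq_nil_iff.1 h)⟩

/-- The two words differ only at places where one has a and the other b, and both letters end up as
j. -/
theorem Word.replaceLetters_map_subst (e : Finset (Fin k)) (j : Fin k) (φ : CombSubspace k)
    (ℓ : VarWord k) {a b : Fin k} (ha : a ∈ insert j e) (hb : b ∈ insert j e) :
    Word.replaceLetters e j (φ.map (ℓ.subst a)) = Word.replaceLetters e j (φ.map (ℓ.subst b)) := by
  have hc : ∀ c : Option (Fin k), (if c.getD a ∈ e then j else c.getD a) =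
      if c.getD b ∈ e then j else c.getD b := by
    intro c
    cases c with
    | none => simp only [Option.getD_none]; grind
    | some c => rfl
  have h1 : ∀ u : VarWord k, (u.subst a).1.map (fun a => if a ∈ e then j else a) =
      (u.subst b).1.map fun a => if a ∈ e then j else a := by
    intro u
    simp only [VarWord.subst, List.map_map]
    exact List.map_congr_left fun c _ => hc c
  apply Subtype.ext
  simp only [Word.replaceLetters, CombSubspace.map_val]
  change (φ.mapList (ℓ.1.map fun o => o.getD a)).map _ = (φ.mapList (ℓ.1.map fun o => o.getD b)).map _
  generalize ℓ.1 = l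
  induction l generalizing φ with
  | nil => rfl
  | cons o l ih =>
    simp only [List.map_cons, CombSubspace.mapList, List.map_append, ih]
    congr 1
    cases o with
    | none => exact h1 _
    | some c => rfl

/-- Along the line whose variable occupies the places of the letters from `e` in `w`, the points
are the words obtained from `w` by replacing these letters. -/
theorem Word.exists_line_replaceLetters {e : Finset (Fin k)} {w : Word k} {i : Fin k}
    (hi : i ∈ e) (hw : i ∈ w.1) :
    ∃ ℓ : VarWord k, ∀ j, ℓ.subst j = Word.replaceLetters e j w := by
  refine ⟨⟨w.1.map fun a => if a ∈ e then none else some a, List.mem_map.2 ⟨i, hw, by simp [hi]⟩⟩,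
    fun j => Subtype.ext ?_⟩
  simp only [VarWord.subst, Word.replaceLetters, List.map_map]
  refine List.map_congr_left fun a _ => ?_
  by_cases ha : a ∈ e <;> simp [ha]

variable {X : Type u} [MeasurableSpace X]

/-- Letters are replaced one at a time: changing a letter of e to i is a move along the line whose
variable occupies that single place. -/
theorem ae_mem_iff_replaceLetters {μ : Measure (Word k → X)} {e : Finset (Fin k)} {A : Set X}
    (hA : MeasurableSet[insensitive μ e] A) {i : Fin k} (hi : i ∈ e) (w : Word k) :
    ∀ᵐ ω ∂μ, (ω w ∈ A ↔ ω (Word.replaceLetters e i w) ∈ A) := by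
  have key : ∀ (v u : List (Fin k)) (h : u ++ v ≠ [])
      (h' : u ++ v.map (fun a => if a ∈ e then i else a) ≠ []),
      ∀ᵐ ω ∂μ, (ω ⟨u ++ v, h⟩ ∈ A ↔
        ω ⟨u ++ v.map (fun a => if a ∈ e then i else a), h'⟩ ∈ A) := by
    intro v
    induction v with
    | nil => simp
    | cons a v ih =>
      intro u h h'
      by_cases ha : a ∈ e
      · have h1 := hA.2 ⟨u.map some ++ none :: v.map some, by simp⟩
        have h2 := ih (u ++ [i]) (by simp) (by simp)
        filter_upwards [h1, h2] with ω h1 h2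
        have h3 := h1 a ha i hi
        simp only [VarWord.subst, List.map_append, List.map_cons, List.map_map,
          Function.comp_def, Option.getD_some, Option.getD_none, List.map_id'] at h3
        simp only [List.append_assoc, List.cons_append, List.nil_append] at h2
        simp only [List.map_cons, ha, if_true]
        exact h3.trans h2
      · have h2 := ih (u ++ [a]) (by simp) (by simp)
        filter_upwards [h2] with ω h2
        simp only [List.append_assoc, List.cons_append, List.nil_append] at h2
        simpa only [List.map_cons, ha, if_false] using h2
  exact key w.1 [] w.2 (Word.replaceLetters e i w).2

end ReplaceLetters

/-! ### Conditional expectation -/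

section CondExp

theorem RelIndep.measureReal_inter {Ω : Type u} {m' m₁ m₂ : MeasurableSpace Ω}
    [mΩ : MeasurableSpace Ω] {μ : Measure Ω} [IsProbabilityMeasure μ] (h : RelIndep μ m' m₁ m₂) {A B : Set Ω}
    (hA : MeasurableSet[m₁] A) (hB : MeasurableSet[m₂] B) :
    μ.real (A ∩ B) = ∫ ω in B, (μ[A.indicator (fun _ => (1 : ℝ)) | m']) ω ∂μ := by
  obtain ⟨⟨hm', hm₁, hm₂⟩, hAB⟩ := h
  have hA' := hm₁ A hA
  have hB' := hm₂ B hB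
  have hint : ∀ {C : Set Ω}, MeasurableSet C → Integrable (C.indicator fun _ => (1 : ℝ)) μ :=
    fun hC => (integrable_const 1).indicator hC
  have e : (fun ω => (μ[A.indicator (fun _ => (1 : ℝ)) | m']) ω * B.indicator (fun _ => 1) ω) =
      B.indicator (μ[A.indicator (fun _ => (1 : ℝ)) | m']) := by
    funext ω
    by_cases hω : ω ∈ B <;> simp [hω]
  have hint2 : Integrable (fun ω => (μ[A.indicator (fun _ => (1 : ℝ)) | m']) ω *
      B.indicator (fun _ => 1) ω) μ := by
    rw [e]
    exact integrable_condExp.indicator hB'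
  calc μ.real (A ∩ B) = ∫ ω, (A ∩ B).indicator (fun _ => (1 : ℝ)) ω ∂μ := by
        rw [integral_indicator (hA'.inter hB')]; simp
    _ = ∫ ω, (μ[(A ∩ B).indicator (fun _ => (1 : ℝ)) | m']) ω ∂μ := (integral_condExp hm').symm
    _ = ∫ ω, (μ[A.indicator (fun _ => (1 : ℝ)) | m']) ω *
          (μ[B.indicator (fun _ => (1 : ℝ)) | m']) ω ∂μ := integral_congr_ae (hAB A B hA hB)
    _ = ∫ ω, (μ[fun ω => (μ[A.indicator (fun _ => (1 : ℝ)) | m']) ω *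
          B.indicator (fun _ => 1) ω | m']) ω ∂μ :=
        integral_congr_ae (condExp_mul_of_stronglyMeasurable_left stronglyMeasurable_condExp
          hint2 (hint hB')).symm
    _ = ∫ ω, (μ[A.indicator (fun _ => (1 : ℝ)) | m']) ω * B.indicator (fun _ => 1) ω ∂μ :=
        integral_condExp hm'
    _ = _ := by rw [e, integral_indicator hB']

theorem condExp_comap_comp {Ω Ω' : Type*} {m : MeasurableSpace Ω'} [mΩ : MeasurableSpace Ω]
    [mΩ' : MeasurableSpace Ω'] {μ : Measure Ω} [IsFiniteMeasure μ] {f : Ω → Ω'}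
    (hf : Measurable f) (hm : m ≤ mΩ')
    {g : Ω' → ℝ} (hg : Integrable g (μ.map f)) :
    μ[g ∘ f | m.comap f] =ᵐ[μ] (μ.map f)[g | m] ∘ f := by
  have hm' : m.comap f ≤ mΩ := (MeasurableSpace.comap_mono hm).trans hf.comap_le
  have hint : Integrable ((μ.map f)[g | m] ∘ f) μ :=
    (integrable_map_measure integrable_condExp.aestronglyMeasurable hf.aemeasurable).1
      integrable_condExp
  refine (ae_eq_condExp_of_forall_setIntegral_eq hm'
    ((integrable_map_measure hg.aestronglyMeasurable hf.aemeasurable).1 hg)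
    (fun _ _ _ => hint.integrableOn) ?_ ?_).symm
  · rintro _ ⟨B, hB, rfl⟩ -
    have h := setIntegral_condExp hm hg hB
    rw [setIntegral_map (hm B hB) integrable_condExp.aestronglyMeasurable hf.aemeasurable,
      setIntegral_map (hm B hB) hg.aestronglyMeasurable hf.aemeasurable] at h
    exact h
  · exact (stronglyMeasurable_condExp.comp_measurable
      (comap_measurable f)).aestronglyMeasurable

theorem integral_eq_of_measureReal_eq {Ω : Type*} {m : MeasurableSpace Ω}
    [mΩ : MeasurableSpace Ω] {μ ν : Measure Ω} [IsFiniteMeasure μ] [IsFiniteMeasure ν] (hm : m ≤ mΩ)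
    (h : ∀ A, MeasurableSet[m] A → μ.real A = ν.real A) {f : Ω → ℝ}
    (hf : StronglyMeasurable[m] f) : ∫ ω, f ω ∂μ = ∫ ω, f ω ∂ν := by
  rw [integral_trim hm hf, integral_trim hm hf]
  congr 1
  refine @Measure.ext _ m _ _ fun A hA => ?_
  rw [trim_measurableSet_eq hm hA, trim_measurableSet_eq hm hA]
  exact (measureReal_eq_measureReal_iff).1 (h A hA)

end CondExp

/-! ### The consequence of satedness for the line-marginal -/

section Sated

open Filter Topology

variable {k : ℕ} {X : Type u} [MeasurableSpace X]

theorem insensitive_le (μ : Measure (Word k → X)) (e : Finset (Fin k)) :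
    insensitive μ e ≤ ‹MeasurableSpace X› := fun _ hA => hA.1

theorem insensitive_anti (μ : Measure (Word k → X)) {e e' : Finset (Fin k)} (h : e ⊆ e') :
    insensitive μ e' ≤ insensitive μ e := fun _ hA => ⟨hA.1, fun ℓ => by
  filter_upwards [hA.2 ℓ] with x hx i hi j hj using hx i (h hi) j (h hj)⟩

theorem insensitiveJoin_le (μ : Measure (Word k → X)) (I : Set (Finset (Fin k))) :
    insensitiveJoin μ I ≤ ‹MeasurableSpace X› :=
  iSup₂_le fun e _ => insensitive_le μ e

theorem isUpSet_ssuperset {e : Finset (Fin k)} (he : e.Nonempty) :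
    IsUpSet {u : Finset (Fin k) | e ⊂ u} :=
  ⟨fun _ hu => by
    have h1 := he.card_pos
    have h2 := Finset.card_lt_card hu
    lia,
    fun _ _ huv hu => lt_of_lt_of_le hu huv⟩

/-- Every strongly stationary law has a strongly stationary extension by further coordinates
`y_j`, `j ∉ e`, that are `e ∪ {j}`-insensitive and that are, as far as the `e`-insensitive sets of
the original coordinate are concerned, jointly distributed with it as the coordinates along a
line. -/
theorem exists_insensitive_extension [NeZero k] [StandardBorelSpace X]
    {μ : Measure (Word k → X)} [IsProbabilityMeasure μ] (hss : IsStronglyStationary μ)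
    (e : Finset (Fin k)) {i : Fin k} (hi : i ∈ e) :
    ∃ ν : Measure (Word k → Option {j // j ∉ e} → X), IsProbabilityMeasure ν ∧
      IsStronglyStationary ν ∧ IsExtension ν μ (fun y => y none) ∧
      (∀ (j : {j // j ∉ e}) (B : Set X), MeasurableSet B →
        MeasurableSet[insensitive ν (insert j.1 e)] {y | y (some j) ∈ B}) ∧
      ∀ (A : Set X) (D : {j // j ∉ e} → Set X), MeasurableSet[insensitive μ e] A →
        (∀ j, MeasurableSet (D j)) →
        (pointMarginal ν).real {y | y none ∈ A ∧ ∀ j, y (some j) ∈ D j} =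
          (lineMarginal μ).real {x | x i ∈ A ∧ ∀ j : {j // j ∉ e}, x j ∈ D j} := by
  -- The coordinate `none` reads the word itself, and `some j` reads it with all letters from e
  -- turned into j.
  obtain ⟨V, ν, hν, hνss, hlim⟩ := exists_stationary_limit hss
    (fun s : Option {j // j ∉ e} => s.elim id fun j => Word.replaceLetters e j)
  refine ⟨ν, hν, hνss, ⟨measurable_pi_apply none, ?_⟩, fun j B hB => ?_, fun A D hA hD => ?_⟩
  · have hm : Measurable fun (y : Word k → Option {j // j ∉ e} → X) w => y w none := by fun_prop
    have : IsProbabilityMeasure (ν.map fun y w => y w none) :=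
      Measure.isProbabilityMeasure_map hm.aemeasurable
    refine ext_of_measureReal_rectangles fun s A hA => ?_
    rw [map_measureReal_apply hm (measurableSet_forall_mem_finset s hA)]
    have h1 := hlim (Fin s.card) (fun c => (s.equivFin.symm c).1) (fun _ => none)
      (fun c => A (s.equivFin.symm c)) fun c => hA _
    have e : ∀ y : Word k → X, (∀ w ∈ s, y w ∈ A w) ↔
        ∀ c, y (s.equivFin.symm c) ∈ A (s.equivFin.symm c) := fun y =>
      ⟨fun h c => h _ (s.equivFin.symm c).2, fun h t ht => by
        simpa using h (s.equivFin ⟨t, ht⟩)⟩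
    have h2 : ∀ φ : CombSubspace k,
        μ.real {ω | ∀ c, ω (φ.map (s.equivFin.symm c).1) ∈ A (s.equivFin.symm c)} =
          μ.real {ω | ∀ w ∈ s, ω w ∈ A w} := by
      intro φ
      conv_rhs => rw [← hss φ]
      rw [map_measureReal_apply (by fun_prop) (measurableSet_forall_mem_finset s hA)]
      congr 1
      ext ω
      exact (e fun w => ω (φ.map w)).symm
    have h3 := tendsto_nhds_unique h1 ((tendsto_congr h2).2 tendsto_const_nhds)
    rw [← h3]
    congr 1
    ext y
    exact e fun w => y w none
  · refine ⟨measurable_pi_apply (some j) hB, fun ℓ => ?_⟩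
    have hnull : ∀ a ∈ insert j.1 e, ∀ b ∈ insert j.1 e,
        ∀ᵐ y ∂ν, y (ℓ.subst a) (some j) ∈ B → y (ℓ.subst b) (some j) ∈ B := by
      intro a ha b hb
      have h1 := hlim Bool (fun c => cond c (ℓ.subst a) (ℓ.subst b)) (fun _ => some j)
        (fun c => cond c B Bᶜ) (by rintro (_ | _); exacts [hB.compl, hB])
      have h2 : ∀ φ : CombSubspace k,
          μ.real {ω | ∀ c : Bool, ω (Word.replaceLetters e j
            (φ.map (cond c (ℓ.subst a) (ℓ.subst b)))) ∈ cond c B Bᶜ} = 0 := by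
        intro φ
        convert! measureReal_empty (μ := μ) using 2
        ext ω
        simp only [Bool.forall_bool, cond_true, cond_false, Set.mem_ofPred_eq,
          Word.replaceLetters_map_subst e j φ ℓ ha hb, Set.mem_compl_iff,
          Set.mem_empty_iff_false, iff_false]
        tauto
      have h3 := tendsto_nhds_unique h1 ((tendsto_congr h2).2 tendsto_const_nhds)
      rw [measureReal_eq_zero_iff] at h3
      rw [ae_iff]
      convert! h3 using 2
      ext y
      simp only [Bool.forall_bool, cond_true, cond_false, Set.mem_ofPred_eq, Set.mem_compl_iff]
      tauto
    simp only [← ae_all_iff] at hnull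
    filter_upwards [hnull] with y hy a ha b hb using ⟨hy a ha b hb, hy b hb a ha⟩
  · have h1 := hlim (Option {j // j ∉ e}) (fun _ => Word.letter i) id
      (fun s => s.elim A D) (by rintro (_ | j); exacts [hA.1, hD j])
    have h2 : ∀ φ : CombSubspace k,
        μ.real {ω | ∀ s : Option {j // j ∉ e}, ω ((s.elim id fun j => Word.replaceLetters e j :
          Word k → Word k) (φ.map (Word.letter i))) ∈ s.elim A D} =
          (lineMarginal μ).real {x | x i ∈ A ∧ ∀ j : {j // j ∉ e}, x j ∈ D j} := by
      intro φ
      -- The variable occurs in the first line of φ, so i occurs in φ(i). Hence the replaced words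
      -- form a genuine line, and e-insensitivity of A trades φ(i) for the i-th point of this line.
      have hmem : i ∈ (φ.map (Word.letter i)).1 := by
        rw [CombSubspace.map_val]
        exact List.mem_append_left _ (List.mem_map.2 ⟨none, (φ 0).2, rfl⟩)
      obtain ⟨ℓ, hℓ⟩ := Word.exists_line_replaceLetters hi hmem
      have hset : MeasurableSet {x : Fin k → X | x i ∈ A ∧ ∀ j : {j // j ∉ e}, x j ∈ D j} := by
        refine (measurable_pi_apply i hA.1).inter ?_
        have : {x : Fin k → X | ∀ j : {j // j ∉ e}, x j ∈ D j} =
          ⋂ j : {j // j ∉ e}, (fun x => x j) ⁻¹' D j := by ext; simp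
        change MeasurableSet {x : Fin k → X | ∀ j : {j // j ∉ e}, x j ∈ D j}
        rw [this]
        exact MeasurableSet.iInter fun j => measurable_pi_apply _ (hD j)
      rw [← map_line_eq_lineMarginal hss ℓ, map_measureReal_apply (by fun_prop) hset]
      refine measureReal_congr ?_
      filter_upwards [ae_mem_iff_replaceLetters hA hi (φ.map (Word.letter i))] with ω hω
      refine propext ?_
      change (∀ s : Option {j // j ∉ e}, _) ↔ (ω (ℓ.subst i) ∈ A ∧ _)
      rw [Option.forall, hℓ, ← hω]
      simp only [hℓ]
      rfl
    have h3 := tendsto_nhds_unique h1 ((tendsto_congr h2).2 tendsto_const_nhds)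
    rw [← h3, ← map_eval_eq_pointMarginal hνss (Word.letter i), map_measureReal_apply]
    · congr 1
      ext y
      simp [Option.forall]
    · fun_prop
    · refine (measurable_pi_apply none hA.1).inter ?_
      have : {y : Option {j // j ∉ e} → X | ∀ j : {j // j ∉ e}, y (some j) ∈ D j} =
        ⋂ j : {j // j ∉ e}, (fun y => y (some j)) ⁻¹' D j := by ext; simp
      change MeasurableSet {y : Option {j // j ∉ e} → X | ∀ j : {j // j ∉ e}, y (some j) ∈ D j}
      rw [this]
      exact MeasurableSet.iInter fun j => measurable_pi_apply _ (hD j)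

/-- In the extension the event D becomes measurable over the sets insensitive for some u ⊋ e, so
satedness replaces 1_A by its projection. The projection is itself Φ_e-measurable, so its integral
over D can be carried back to the line-marginal. -/
theorem measureReal_line_eq_setIntegral_condExp [NeZero k] [StandardBorelSpace X]
    {μ : Measure (Word k → X)} [IsProbabilityMeasure μ] (hss : IsStronglyStationary μ)
    {e : Finset (Fin k)} {i : Fin k} (hi : i ∈ e) (hsat : IsSated μ {u | e ⊂ u}) {A : Set X}
    (hA : MeasurableSet[insensitive μ e] A) {D : Set ({j // j ∉ e} → X)} (hD : MeasurableSet D) :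
    (lineMarginal μ).real ({x | x i ∈ A} ∩ {x | (fun j : {j // j ∉ e} => x j) ∈ D}) =
      ∫ x in {x | (fun j : {j // j ∉ e} => x j) ∈ D},
        ((pointMarginal μ)[A.indicator (fun _ => (1 : ℝ)) |
          insensitiveJoin μ {u | e ⊂ u}]) (x i) ∂(lineMarginal μ) := by
  obtain ⟨ν, hν, hνss, hext, hins, hjoint⟩ := exists_insensitive_extension hss e hi
  have hQ : IsProbabilityMeasure (pointMarginal ν) :=
    Measure.isProbabilityMeasure_map (measurable_pi_apply _).aemeasurable
  have hL : IsProbabilityMeasure (lineMarginal μ) :=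
    Measure.isProbabilityMeasure_map (Measurable.aemeasurable (by fun_prop))
  have hP : IsProbabilityMeasure (pointMarginal μ) :=
    Measure.isProbabilityMeasure_map (measurable_pi_apply _).aemeasurable
  have hsome : Measurable fun (y : Option {j // j ∉ e} → X) j => y (some j) := by fun_prop
  have hrestr : Measurable fun (x : Fin k → X) (j : {j // j ∉ e}) => x j := by fun_prop
  have hjoint' : ∀ A : Set X, MeasurableSet[insensitive μ e] A →
      (pointMarginal ν).real ({y | y none ∈ A} ∩ {y | (fun j => y (some j)) ∈ D}) =
        (lineMarginal μ).real ({x | x i ∈ A} ∩ {x | (fun j : {j // j ∉ e} => x j) ∈ D}) := by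
    intro A hA
    have hA1 : MeasurableSet {y : Option {j // j ∉ e} → X | y none ∈ A} :=
      measurable_pi_apply none hA.1
    have hA2 : MeasurableSet {x : Fin k → X | x i ∈ A} := measurable_pi_apply i hA.1
    have hext : ((pointMarginal ν).restrict {y | y none ∈ A}).map (fun y j => y (some j)) =
        ((lineMarginal μ).restrict {x | x i ∈ A}).map fun x (j : {j // j ∉ e}) => x j := by
      refine ext_of_measureReal_rectangles fun s B hB => ?_
      classical
      have hmB := measurableSet_forall_mem_finset s hB
      rw [map_measureReal_apply hsome hmB, map_measureReal_apply hrestr hmB,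
        measureReal_restrict_apply (hsome hmB), measureReal_restrict_apply (hrestr hmB)]
      have h := hjoint A (fun j => if j ∈ s then B j else Set.univ) hA fun j => by
        split_ifs
        exacts [hB j, MeasurableSet.univ]
      have e1 : ∀ z : {j // j ∉ e} → X, (∀ j, z j ∈ if j ∈ s then B j else Set.univ) ↔
          ∀ j ∈ s, z j ∈ B j := by
        intro z
        refine forall_congr' fun j => ?_
        split_ifs with hj <;> simp [hj]
      convert! h using 2
      · ext y
        exact and_comm.trans (and_congr_right fun _ => (e1 fun j => y (some j)).symm)
      · ext x
        exact and_comm.trans (and_congr_right fun _ => (e1 fun j => x j).symm)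
    have h := congrArg (fun ρ : Measure ({j // j ∉ e} → X) => ρ.real D) hext
    rw [map_measureReal_apply hsome hD, map_measureReal_apply hrestr hD,
      measureReal_restrict_apply (hsome hD), measureReal_restrict_apply (hrestr hD)] at h
    rw [Set.inter_comm {y : Option {j // j ∉ e} → X | y none ∈ A},
      Set.inter_comm {x : Fin k → X | x i ∈ A}]
    exact h
  have hle : insensitiveJoin μ {u | e ⊂ u} ≤ insensitive μ e :=
    iSup₂_le fun u hu => insensitive_anti μ hu.1
  have hB : MeasurableSet[insensitiveJoin ν {u | e ⊂ u}]
      {y : Option {j // j ∉ e} → X | (fun j => y (some j)) ∈ D} := by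
    refine @measurable_pi_lambda _ _ _ (insensitiveJoin ν {u | e ⊂ u}) _ _ (fun j B hB => ?_) D hD
    exact le_iSup₂_of_le (f := fun u (_ : u ∈ {u | e ⊂ u}) => insensitive ν u) (insert j.1 e)
      (Finset.ssubset_insert j.2) le_rfl _ (hins j B hB)
  have hrel := hsat _ ν (fun y => y none) hνss hext
  have h1 := hrel.measureReal_inter (A := {y | y none ∈ A}) ⟨A, hA.1, rfl⟩ hB
  have hmap : (pointMarginal ν).map (fun y => y none) = pointMarginal μ := by
    rw [← hext.2]
    unfold pointMarginal
    rw [Measure.map_map (measurable_pi_apply _) (by fun_prop),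
      Measure.map_map (measurable_pi_apply _) (by fun_prop)]
    rfl
  have hcond := condExp_comap_comp (μ := pointMarginal ν) (measurable_pi_apply none)
    (insensitiveJoin_le μ {u | e ⊂ u}) (g := A.indicator fun _ => (1 : ℝ)) (by
      rw [hmap]
      exact (integrable_const 1).indicator hA.1)
  rw [hmap] at hcond
  rw [← hjoint' A hA, h1]
  have hstep : ∫ y in {y | (fun j => y (some j)) ∈ D},
      ((pointMarginal ν)[{y : Option {j // j ∉ e} → X | y none ∈ A}.indicator (fun _ => (1 : ℝ)) |
        (insensitiveJoin μ {u | e ⊂ u}).comap fun y => y none]) y ∂(pointMarginal ν) =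
      ∫ y in {y | (fun j => y (some j)) ∈ D}, ((pointMarginal μ)[A.indicator (fun _ => (1 : ℝ)) |
          insensitiveJoin μ {u | e ⊂ u}]) (y none) ∂(pointMarginal ν) :=
    integral_congr_ae (ae_restrict_of_ae hcond)
  rw [hstep]
  have hsm : StronglyMeasurable[insensitive μ e] ((pointMarginal μ)[A.indicator (fun _ => (1 : ℝ)) |
          insensitiveJoin μ {u | e ⊂ u}]) := stronglyMeasurable_condExp.mono hle
  rw [← integral_map (φ := fun y : Option {j // j ∉ e} → X => y none)
      (measurable_pi_apply none).aemeasurable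
      (hsm.mono (insensitive_le μ e)).aestronglyMeasurable,
    ← integral_map (φ := fun x : Fin k → X => x i) (measurable_pi_apply i).aemeasurable
      (hsm.mono (insensitive_le μ e)).aestronglyMeasurable]
  refine integral_eq_of_measureReal_eq (insensitive_le μ e) (fun B hB => ?_) hsm
  rw [map_measureReal_apply (measurable_pi_apply none) hB.1,
    map_measureReal_apply (measurable_pi_apply i) hB.1,
    measureReal_restrict_apply (measurable_pi_apply none hB.1),
    measureReal_restrict_apply (measurable_pi_apply i hB.1)]
  exact hjoint' B hB

end Sated

/-! ### Relative independence of joins -/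

section Joins

theorem integral_mul_eq_integral_mul_condExp {Ω : Type*} {m : MeasurableSpace Ω}
    [mΩ : MeasurableSpace Ω] {P : Measure Ω} [IsFiniteMeasure P] (hm : m ≤ mΩ) {f g : Ω → ℝ}
    (hf : StronglyMeasurable[m] f) (hfg : Integrable (f * g) P) (hg : Integrable g P) :
    ∫ ω, f ω * g ω ∂P = ∫ ω, f ω * (P[g | m]) ω ∂P := by
  rw [← integral_condExp hm (f := fun ω => f ω * g ω)]
  exact integral_congr_ae (condExp_mul_of_stronglyMeasurable_left hf hfg hg)

variable {Ω : Type u}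

/-- The indicator function of a set. -/
noncomputable abbrev ind (A : Set Ω) : Ω → ℝ := A.indicator fun _ => 1

theorem integrable_ind [MeasurableSpace Ω] {P : Measure Ω} [IsFiniteMeasure P] {A : Set Ω}
    (hA : MeasurableSet A) : Integrable (ind A) P :=
  (integrable_const 1).indicator hA

theorem stronglyMeasurable_ind {m : MeasurableSpace Ω} {A : Set Ω} (hA : MeasurableSet[m] A) :
    StronglyMeasurable[m] (ind A) :=
  stronglyMeasurable_const.indicator hA

theorem ind_mul (A : Set Ω) (f : Ω → ℝ) : ind A * f = A.indicator f := by
  funext ω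
  by_cases h : ω ∈ A <;> simp [h]

theorem setIntegral_eq_integral_ind_mul [MeasurableSpace Ω] {P : Measure Ω} {A : Set Ω}
    (hA : MeasurableSet A) (f : Ω → ℝ) : ∫ ω in A, f ω ∂P = ∫ ω, ind A ω * f ω ∂P := by
  rw [← integral_indicator hA, ← ind_mul]
  rfl

theorem integrable_ind_mul [MeasurableSpace Ω] {P : Measure Ω} {A : Set Ω}
    (hA : MeasurableSet A) {f : Ω → ℝ} (hf : Integrable f P) : Integrable (ind A * f) P := by
  rw [ind_mul]
  exact hf.indicator hA

theorem integrable_mul_condExp_ind {m : MeasurableSpace Ω} [mΩ : MeasurableSpace Ω]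
    {P : Measure Ω} [IsFiniteMeasure P] {B : Set Ω} {f : Ω → ℝ} (hf : Integrable f P) :
    Integrable (f * P[ind B | m]) P := by
  refine hf.mul_bdd (c := 1) integrable_condExp.aestronglyMeasurable ?_
  have h : ∀ᵐ ω ∂P, |ind B ω| ≤ 1 := by
    refine Filter.Eventually.of_forall fun ω => ?_
    by_cases hω : ω ∈ B <;> simp [hω]
  simpa using ae_bdd_abs_condExp_of_ae_bdd_abs (m := m) h

theorem sup_eq_generateFrom_inter (m₁ m₂ : MeasurableSpace Ω) :
    m₁ ⊔ m₂ = MeasurableSpace.generateFrom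
      {C | ∃ A B, MeasurableSet[m₁] A ∧ MeasurableSet[m₂] B ∧ C = A ∩ B} := by
  refine le_antisymm (sup_le (fun A hA => ?_) fun B hB => ?_)
    (MeasurableSpace.generateFrom_le ?_)
  · exact MeasurableSpace.measurableSet_generateFrom
      ⟨A, Set.univ, hA, MeasurableSet.univ, (Set.inter_univ A).symm⟩
  · exact MeasurableSpace.measurableSet_generateFrom
      ⟨Set.univ, B, MeasurableSet.univ, hB, (Set.univ_inter B).symm⟩
  · rintro _ ⟨A, B, hA, hB, rfl⟩
    exact MeasurableSet.inter (le_sup_left (a := m₁) A hA) (le_sup_right (a := m₁) B hB)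

theorem isPiSystem_inter (m₁ m₂ : MeasurableSpace Ω) :
    IsPiSystem {C : Set Ω | ∃ A B, MeasurableSet[m₁] A ∧ MeasurableSet[m₂] B ∧ C = A ∩ B} := by
  rintro _ ⟨A, B, hA, hB, rfl⟩ _ ⟨A', B', hA', hB', rfl⟩ -
  exact ⟨A ∩ A', B ∩ B', hA.inter hA', hB.inter hB', Set.inter_inter_inter_comm _ _ _ _⟩

theorem setIntegral_eq_of_generateFrom {m₁ : MeasurableSpace Ω} [mΩ : MeasurableSpace Ω]
    {P : Measure Ω} {S : Set (Set Ω)}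
    (hS : m₁ = MeasurableSpace.generateFrom S) (hpi : IsPiSystem S) (hm₁ : m₁ ≤ mΩ)
    {f g : Ω → ℝ} (hf : Integrable f P) (hg : Integrable g P) (huniv : Set.univ ∈ S)
    (h : ∀ A ∈ S, ∫ ω in A, f ω ∂P = ∫ ω in A, g ω ∂P) {A : Set Ω} (hA : MeasurableSet[m₁] A) :
    ∫ ω in A, f ω ∂P = ∫ ω in A, g ω ∂P := by
  induction A, hA using MeasurableSpace.induction_on_inter hS hpi with
  | empty => simp
  | basic A hA => exact h A hA
  | compl A hA ih =>
    have h' := h _ huniv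
    rw [setIntegral_univ, setIntegral_univ] at h'
    rw [setIntegral_compl (hm₁ A hA) hf, setIntegral_compl (hm₁ A hA) hg, ih, h']
  | iUnion A hd hA ih =>
    rw [integral_iUnion (fun i => hm₁ _ (hA i)) hd hf.integrableOn,
      integral_iUnion (fun i => hm₁ _ (hA i)) hd hg.integrableOn]
    simp only [ih]

/-- Every `A ∈ m₁` and `B ∈ m₂` satisfy `P (A ∩ B) = ∫_A P[B | m']`. -/
def SplitsOver [mΩ : MeasurableSpace Ω] (P : Measure Ω) (m' m₁ m₂ : MeasurableSpace Ω) : Prop :=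
  ∀ A B, MeasurableSet[m₁] A → MeasurableSet[m₂] B →
    P.real (A ∩ B) = ∫ ω in A, (P[ind B | m']) ω ∂P

section

variable {m' m₁ m₂ n₁ n₂ : MeasurableSpace Ω} [mΩ : MeasurableSpace Ω] {P : Measure Ω}
  [IsProbabilityMeasure P]

/-- Both sides equal the integral of the product of the two conditional expectations. -/
theorem setIntegral_condExp_ind_comm (hm' : m' ≤ mΩ) {A B : Set Ω} (hA : MeasurableSet A)
    (hB : MeasurableSet B) :
    ∫ ω in A, (P[ind B | m']) ω ∂P = ∫ ω in B, (P[ind A | m']) ω ∂P := by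
  have key : ∀ {A B : Set Ω}, MeasurableSet A →
      ∫ ω in A, (P[ind B | m']) ω ∂P = ∫ ω, (P[ind B | m']) ω * (P[ind A | m']) ω ∂P := by
    intro A B hA
    rw [setIntegral_eq_integral_ind_mul hA, ← integral_mul_eq_integral_mul_condExp hm'
      stronglyMeasurable_condExp _ (integrable_ind hA)]
    · simp only [mul_comm]
    · rw [mul_comm]
      exact integrable_ind_mul hA integrable_condExp
  rw [key hA, key hB]
  simp only [mul_comm]

theorem SplitsOver.symm (h : SplitsOver P m' m₁ m₂) (hm' : m' ≤ mΩ) (hm₁ : m₁ ≤ mΩ)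
    (hm₂ : m₂ ≤ mΩ) : SplitsOver P m' m₂ m₁ := by
  intro B A hB hA
  rw [Set.inter_comm, h A B hA hB, setIntegral_condExp_ind_comm hm' (hm₁ A hA) (hm₂ B hB)]

theorem SplitsOver.condExp_eq (h : SplitsOver P m' m₁ m₂) (hm' : m' ≤ m₁) (hm₁ : m₁ ≤ mΩ)
    (hm₂ : m₂ ≤ mΩ) {B : Set Ω} (hB : MeasurableSet[m₂] B) :
    P[ind B | m₁] =ᵐ[P] P[ind B | m'] := by
  refine (ae_eq_condExp_of_forall_setIntegral_eq hm₁ (integrable_ind (hm₂ B hB))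
    (fun _ _ _ => integrable_condExp.integrableOn) (fun A hA _ => ?_)
    (stronglyMeasurable_condExp.mono hm').aestronglyMeasurable).symm
  rw [← h A B hA hB, setIntegral_indicator (hm₂ B hB)]
  simp

/-- A test set C from m' can be absorbed into A because m' ≤ m₁; it then remains to project 1_A
against the m'-measurable function 1_C E(1_B | m'). -/
theorem SplitsOver.relIndep (h : SplitsOver P m' m₁ m₂) (hm'₁ : m' ≤ m₁) (hm₁ : m₁ ≤ mΩ)
    (hm₂ : m₂ ≤ mΩ) : RelIndep P m' m₁ m₂ := by
  have hm' := hm'₁.trans hm₁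
  refine ⟨⟨hm', hm₁, hm₂⟩, fun A B hA hB => ?_⟩
  have hA' := hm₁ A hA
  have hB' := hm₂ B hB
  have hint : Integrable (P[ind A | m'] * P[ind B | m']) P :=
    integrable_mul_condExp_ind integrable_condExp
  refine (ae_eq_condExp_of_forall_setIntegral_eq hm' (integrable_ind (hA'.inter hB'))
    (fun _ _ _ => hint.integrableOn) (fun C hC _ => ?_)
    (stronglyMeasurable_condExp.mul stronglyMeasurable_condExp).aestronglyMeasurable).symm
  have hC' := hm' C hC
  have hβ : StronglyMeasurable[m'] (ind C * P[ind B | m']) :=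
    (stronglyMeasurable_ind hC).mul stronglyMeasurable_condExp
  have h1 := integral_mul_eq_integral_mul_condExp (P := P) (g := ind A) hm' hβ (by
    rw [mul_comm]
    exact integrable_ind_mul hA' (integrable_ind_mul hC' integrable_condExp)) (integrable_ind hA')
  have h2 := h (A ∩ C) B (hA.inter (hm'₁ C hC)) hB
  rw [setIntegral_eq_integral_ind_mul (hA'.inter hC')] at h2
  have e1 : ∀ ω, ind (A ∩ C) ω * (P[ind B | m']) ω = (ind C * P[ind B | m']) ω * ind A ω := by
    intro ω
    by_cases h1 : ω ∈ A <;> by_cases h2 : ω ∈ C <;> simp [h1, h2]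
  simp only [e1] at h2
  rw [setIntegral_indicator (hA'.inter hB'), setIntegral_eq_integral_ind_mul hC']
  have e2 : C ∩ (A ∩ B) = A ∩ C ∩ B := by
    ext ω; simp only [Set.mem_inter_iff]; tauto
  have e3 : ∀ ω, ind C ω * (P[ind A | m'] * P[ind B | m']) ω =
      (ind C * P[ind B | m']) ω * (P[ind A | m']) ω := by
    intro ω
    simp only [Pi.mul_apply]
    ring
  simp only [e3, ← h1, ← h2, e2, setIntegral_const, smul_eq_mul, mul_one]

/-- Splitting over `m'` may be checked on the intersections of sets from two `σ`-algebras that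
generate `m₁`. -/
theorem splitsOver_sup (hn₁ : n₁ ≤ mΩ) (hn₂ : n₂ ≤ mΩ)
    (hm₂ : m₂ ≤ mΩ)
    (h : ∀ H F B, MeasurableSet[n₁] H → MeasurableSet[n₂] F → MeasurableSet[m₂] B →
      ∫ ω, ind H ω * ind F ω * ind B ω ∂P = ∫ ω, ind H ω * ind F ω * (P[ind B | m']) ω ∂P) :
    SplitsOver P m' (n₁ ⊔ n₂) m₂ := by
  intro A B hA hB
  have hB' := hm₂ B hB
  have hrw : P.real (A ∩ B) = ∫ ω in A, ind B ω ∂P := by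
    rw [setIntegral_indicator hB']; simp
  rw [hrw]
  refine setIntegral_eq_of_generateFrom (sup_eq_generateFrom_inter n₁ n₂)
    (isPiSystem_inter n₁ n₂) (sup_le hn₁ hn₂) (integrable_ind hB') integrable_condExp
    ⟨Set.univ, Set.univ, MeasurableSet.univ, MeasurableSet.univ, (Set.univ_inter _).symm⟩ ?_ hA
  rintro _ ⟨H, F, hH, hF, rfl⟩
  have e : ∀ ω, ind (H ∩ F) ω = ind H ω * ind F ω := by
    intro ω
    by_cases h1 : ω ∈ H <;> by_cases h2 : ω ∈ F <;> simp [h1, h2]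
  rw [setIntegral_eq_integral_ind_mul ((hn₁ H hH).inter (hn₂ F hF)),
    setIntegral_eq_integral_ind_mul ((hn₁ H hH).inter (hn₂ F hF))]
  simp only [e]
  exact h H F B hH hF hB

end

/-! ### Induction over up-sets -/

variable {k : ℕ} {O : Finset (Fin k) → MeasurableSpace Ω} [mΩ : MeasurableSpace Ω] {P : Measure Ω}
  [IsProbabilityMeasure P]

theorem IsUpSet.nonempty_of_mem {I : Set (Finset (Fin k))} (hI : IsUpSet I) {e : Finset (Fin k)}
    (he : e ∈ I) : e.Nonempty :=
  Finset.card_pos.1 (by have := hI.1 e he; lia)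

/-- If the projection of every `O e` to the join over an up-set that omits `e` lies in the join of
the `O u` with `u` strictly larger than `e`, then the joins over up-sets are relatively independent
over the join over their intersection. -/
theorem splitsOver_join (hO : ∀ e, e.Nonempty → O e ≤ mΩ)
    (hproj : ∀ (e : Finset (Fin k)) (I : Set (Finset (Fin k))), e.Nonempty → IsUpSet I → e ∉ I →
      ∀ A, MeasurableSet[O e] A → ∃ h : Ω → ℝ, StronglyMeasurable[⨆ u ∈ {u | e ⊂ u}, O u] h ∧
        Integrable h P ∧ ∀ B, MeasurableSet[⨆ u ∈ I, O u] B → P.real (A ∩ B) = ∫ ω in B, h ω ∂P)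
    {I I' : Set (Finset (Fin k))} (hI : IsUpSet I) (hI' : IsUpSet I') :
    SplitsOver P (⨆ u ∈ I ∩ I', O u) (⨆ u ∈ I, O u) (⨆ u ∈ I', O u) := by
  have hle : ∀ I : Set (Finset (Fin k)), IsUpSet I → ⨆ u ∈ I, O u ≤ mΩ := fun I hI =>
    iSup₂_le fun u hu => hO u (hI.nonempty_of_mem hu)
  have hinter : ∀ {I I' : Set (Finset (Fin k))}, IsUpSet I → IsUpSet I' → IsUpSet (I ∩ I') :=
    fun h h' => ⟨fun e he => h.1 e he.1, h.2.inter h'.2⟩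
  have hmono : ∀ {I I' : Set (Finset (Fin k))}, I ⊆ I' → ⨆ u ∈ I, O u ≤ ⨆ u ∈ I', O u :=
    fun h => biSup_mono h
  have hm₂ := hle I' hI'
  obtain ⟨n, hn⟩ : ∃ n, I.ncard = n := ⟨_, rfl⟩
  induction n generalizing I with
  | zero =>
    have hI0 : I = ∅ := (Set.ncard_eq_zero I.toFinite).1 hn
    subst hI0
    intro A B hA hB
    rw [iSup_emptyset, MeasurableSpace.measurableSet_bot_iff] at hA
    rcases hA with rfl | rfl
    · simp
    · rw [setIntegral_univ, integral_condExp (hle _ (hinter hI hI')),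
        integral_indicator (hm₂ B hB)]
      simp
  | succ n ih =>
    have hne : I.Nonempty := by
      rw [← Set.ncard_pos I.toFinite]; lia
    -- Minimality of e keeps I \ {e} an up-set.
    obtain ⟨e, heI, hemin⟩ := I.toFinite.exists_minimal hne
    have hen := hI.nonempty_of_mem heI
    have hI₀ : IsUpSet (I \ {e}) := by
      refine ⟨fun u hu => hI.1 u hu.1, fun u v huv hu => ⟨hI.2 huv hu.1, ?_⟩⟩
      rintro rfl
      exact hu.2 (le_antisymm huv (hemin hu.1 huv))
    have hcard : (I \ {e}).ncard = n := by
      rw [Set.ncard_sdiff_singleton_of_mem heI]; lia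
    have hIH := ih hI₀ hcard
    have hm₀ := hle _ hI₀
    have hsup : ⨆ u ∈ I, O u = (⨆ u ∈ I \ {e}, O u) ⊔ O e := by
      rw [sup_comm, ← iSup_insert, Set.insert_sdiff_singleton, Set.insert_eq_of_mem heI]
    have hm'₀ : ⨆ u ∈ (I \ {e}) ∩ I', O u ≤ mΩ := hle _ (hinter hI₀ hI')
    rw [hsup]
    refine splitsOver_sup hm₀ (hO e hen) hm₂ fun H F B hH hF hB => ?_
    have hH' := hm₀ H hH
    have hF' := hO e hen F hF
    have hB' := hm₂ B hB
    by_cases heI' : e ∈ I'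
    · have hm' : ⨆ u ∈ I ∩ I', O u ≤ mΩ := hle _ (hinter hI hI')
      have hFm' : MeasurableSet[⨆ u ∈ I ∩ I', O u] F :=
        le_iSup₂_of_le (f := fun u (_ : u ∈ I ∩ I') => O u) e ⟨heI, heI'⟩ le_rfl F hF
      -- Here F already belongs to the join over I ∩ I'. By induction, projecting 1_H to the join
      -- over I' gives η, so 1_H 1_F may be replaced by η 1_F, which is measurable over I ∩ I'.
      have hη := (hIH.symm hm'₀ hm₀ hm₂).condExp_eq (hmono Set.inter_subset_right) hm₂ hm₀ hH
      set η := P[ind H | ⨆ u ∈ (I \ {e}) ∩ I', O u] with hηdef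
      have hηm : StronglyMeasurable[⨆ u ∈ I ∩ I', O u] η :=
        stronglyMeasurable_condExp.mono
          (hmono (Set.inter_subset_inter_left _ Set.sdiff_subset))
      have key : ∀ f : Ω → ℝ, StronglyMeasurable[⨆ u ∈ I', O u] f → Integrable f P →
          ∫ ω, ind H ω * ind F ω * f ω ∂P = ∫ ω, (η * ind F) ω * f ω ∂P := by
        intro f hf hfi
        have hFf : StronglyMeasurable[⨆ u ∈ I', O u] (ind F * f) :=
          (stronglyMeasurable_ind (hmono Set.inter_subset_right F hFm')).mul hf
        have h1 := integral_mul_eq_integral_mul_condExp (P := P) hm₂ hFf (g := ind H) (by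
          rw [mul_comm]
          exact integrable_ind_mul hH' (integrable_ind_mul hF' hfi)) (integrable_ind hH')
        have h2 : ∫ ω, (ind F * f) ω * (P[ind H | ⨆ u ∈ I', O u]) ω ∂P =
            ∫ ω, (ind F * f) ω * η ω ∂P := by
          refine integral_congr_ae ?_
          filter_upwards [hη] with ω hω
          rw [hω]
        rw [h2] at h1
        convert! h1 using 2
        · funext ω
          simp only [Pi.mul_apply]
          ring
        · funext ω
          simp only [Pi.mul_apply]
          ring
      rw [key _ (stronglyMeasurable_ind hB) (integrable_ind hB'),
        key _ (stronglyMeasurable_condExp.mono (hmono Set.inter_subset_right)) integrable_condExp]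
      refine integral_mul_eq_integral_mul_condExp hm' (hηm.mul (stronglyMeasurable_ind hFm')) ?_
        (integrable_ind hB')
      rw [mul_comm η, mul_comm]
      exact integrable_ind_mul hB' (integrable_ind_mul hF' integrable_condExp)
    · have hII : I ∩ I' = (I \ {e}) ∩ I' := by
        ext u
        simp only [Set.mem_inter_iff, Set.mem_sdiff, Set.mem_singleton_iff]
        grind
      rw [hII]
      -- This up-set omits e and carries both H and B, so 1_F may be replaced by h. As h lives on
      -- the strict supersets of e, all in I \ {e}, the induction hypothesis can replace 1_B by β
      -- next to 1_H h; finally h is turned back into 1_F.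
      have hI'' : IsUpSet ((I \ {e}) ∪ I') :=
        ⟨fun u hu => hu.elim (hI₀.1 u) (hI'.1 u), hI₀.2.union hI'.2⟩
      have hm'' := hle _ hI''
      obtain ⟨h, hh, hhi, hhB⟩ := hproj e _ hen hI'' (by simp [heI']) F hF
      have hJ : {u | e ⊂ u} ⊆ I \ {e} := fun u hu => ⟨hI.2 hu.1 heI, fun h => hu.ne h.symm⟩
      have hh₀ : StronglyMeasurable[⨆ u ∈ I \ {e}, O u] h := hh.mono (hmono hJ)
      have hFh : h =ᵐ[P] P[ind F | ⨆ u ∈ (I \ {e}) ∪ I', O u] := by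
        refine ae_eq_condExp_of_forall_setIntegral_eq hm'' (integrable_ind hF')
          (fun _ _ _ => hhi.integrableOn) (fun B hB _ => ?_)
          (hh₀.mono (hmono Set.subset_union_left)).aestronglyMeasurable
        rw [← hhB B hB, setIntegral_indicator hF', Set.inter_comm]
        simp
      have hβ := hIH.condExp_eq (hmono Set.inter_subset_left) hm₀ hm₂ hB
      set β := P[ind B | ⨆ u ∈ (I \ {e}) ∩ I', O u] with hβdef
      have hHβ : StronglyMeasurable[⨆ u ∈ (I \ {e}) ∪ I', O u] (ind H * β) :=
        (stronglyMeasurable_ind (hmono Set.subset_union_left H hH)).mul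
          (stronglyMeasurable_condExp.mono
            (hmono (Set.inter_subset_left.trans Set.subset_union_left)))
      have hHB : MeasurableSet[⨆ u ∈ (I \ {e}) ∪ I', O u] (H ∩ B) :=
        (hmono Set.subset_union_left H hH).inter (hmono Set.subset_union_right B hB)
      calc ∫ ω, ind H ω * ind F ω * ind B ω ∂P = P.real (F ∩ (H ∩ B)) := by
            have e1 : ∀ ω, ind H ω * ind F ω * ind B ω = ind (F ∩ (H ∩ B)) ω := by
              intro ω
              by_cases h1 : ω ∈ H <;> by_cases h2 : ω ∈ F <;> by_cases h3 : ω ∈ B <;>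
                simp [h1, h2, h3]
            simp only [e1]
            rw [integral_indicator (hF'.inter (hH'.inter hB'))]
            simp
        _ = ∫ ω in H ∩ B, h ω ∂P := hhB _ hHB
        _ = ∫ ω, (ind H * h) ω * ind B ω ∂P := by
            rw [setIntegral_eq_integral_ind_mul (hH'.inter hB')]
            refine integral_congr_ae (Filter.Eventually.of_forall fun ω => ?_)
            by_cases h1 : ω ∈ H <;> by_cases h3 : ω ∈ B <;> simp [h1, h3]
        _ = ∫ ω, (ind H * h) ω * (P[ind B | ⨆ u ∈ I \ {e}, O u]) ω ∂P := by
            refine integral_mul_eq_integral_mul_condExp hm₀ ((stronglyMeasurable_ind hH).mul hh₀)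
              ?_ (integrable_ind hB')
            rw [mul_comm]
            exact integrable_ind_mul hB' (integrable_ind_mul hH' hhi)
        _ = ∫ ω, (ind H * β) ω * (P[ind F | ⨆ u ∈ (I \ {e}) ∪ I', O u]) ω ∂P := by
            refine integral_congr_ae ?_
            filter_upwards [hβ, hFh] with ω h1 h2
            rw [h1, ← h2]
            simp only [Pi.mul_apply]
            ring
        _ = ∫ ω, (ind H * β) ω * ind F ω ∂P := by
            refine (integral_mul_eq_integral_mul_condExp hm'' hHβ ?_ (integrable_ind hF')).symm
            rw [mul_comm]
            exact integrable_ind_mul hF' (integrable_ind_mul hH' integrable_condExp)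
        _ = ∫ ω, ind H ω * ind F ω * β ω ∂P := by
            refine integral_congr_ae (Filter.Eventually.of_forall fun ω => ?_)
            simp only [Pi.mul_apply]
            ring

end Joins

/-! ### Passing to the completion -/

section Completion

theorem eventuallyMeasurableSpace_mono {α : Type*} {m m' : MeasurableSpace α} (h : m ≤ m')
    (l : Filter α) [CountableInterFilter l] :
    eventuallyMeasurableSpace m l ≤ eventuallyMeasurableSpace m' l :=
  fun _ ⟨t, ht, hst⟩ => ⟨t, h t ht, hst⟩

/-- The identity map from a space with its null-measurable sets. -/
def ofNull {α : Type*} [MeasurableSpace α] (μ : Measure α) : NullMeasurableSpace α μ → α := id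

theorem measurable_ofNull {α : Type*} [MeasurableSpace α] (μ : Measure α) :
    Measurable (ofNull μ) :=
  fun _ hs => hs.nullMeasurableSet

theorem map_ofNull_completion {α : Type*} [MeasurableSpace α] (μ : Measure α) :
    μ.completion.map (ofNull μ) = μ := by
  refine Measure.ext fun s hs => ?_
  rw [Measure.map_apply (measurable_ofNull μ) hs]
  exact Measure.completion_apply μ s

theorem setIntegral_completion {α : Type*} [MeasurableSpace α]
    (μ : Measure α) {f : α → ℝ} (hf : StronglyMeasurable f) {B : Set α} (hB : MeasurableSet B) :
    ∫ x in ofNull μ ⁻¹' B, f (ofNull μ x) ∂μ.completion = ∫ x in B, f x ∂μ := by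
  have h := setIntegral_map (μ := μ.completion) hB (f := f) hf.aestronglyMeasurable
    (measurable_ofNull μ).aemeasurable
  rw [map_ofNull_completion] at h
  exact h.symm

instance completion.isProbabilityMeasure {α : Type*} [MeasurableSpace α] (μ : Measure α)
    [IsProbabilityMeasure μ] : IsProbabilityMeasure μ.completion :=
  ⟨(Measure.completion_apply μ Set.univ).trans measure_univ⟩

variable {k : ℕ} {X : Type u} [MeasurableSpace X]

/-- Full satedness speaks of nonempty up-sets only; this supplies the case e = [k], which has no
strict supersets. The join over the empty family is trivial. -/
theorem isSated_empty [NeZero k] (μ : Measure (Word k → X)) : IsSated μ ∅ := by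
  intro Y _ _ ν _ π hν hext
  have hP : IsProbabilityMeasure (pointMarginal ν) :=
    Measure.isProbabilityMeasure_map (measurable_pi_apply _).aemeasurable
  refine ⟨⟨(MeasurableSpace.comap_mono (insensitiveJoin_le μ ∅)).trans hext.1.comap_le,
    hext.1.comap_le, insensitiveJoin_le ν ∅⟩, fun A B hA hB => ?_⟩
  have hm := (MeasurableSpace.comap_mono (insensitiveJoin_le μ ∅)).trans hext.1.comap_le
  rw [insensitiveJoin, iSup_emptyset, MeasurableSpace.measurableSet_bot_iff] at hB
  rcases hB with rfl | rfl
  · simp only [Set.inter_empty, Set.indicator_empty]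
    rw [show (fun _ : Y => (0 : ℝ)) = 0 from rfl, condExp_zero]
    simp only [Pi.zero_apply, mul_zero]
    rfl
  · simp only [Set.inter_univ, Set.indicator_univ, condExp_const hm]
    simp

theorem oblique_le (μ : Measure (Word k → X)) {e : Finset (Fin k)} (he : e.Nonempty) :
    oblique μ e ≤
      (inferInstance : MeasurableSpace (NullMeasurableSpace (Fin k → X) (lineMarginal μ))) := by
  obtain ⟨i, hi⟩ := he
  rw [oblique_eq μ e i hi]
  exact eventuallyMeasurableSpace_mono
    ((MeasurableSpace.comap_mono (insensitive_le μ e)).trans (measurable_pi_apply i).comap_le) _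

/-- Up to null sets, the sets in the oblique join over an up-set that omits `e` are determined by
the coordinates outside `e`. -/
theorem obliqueJoin_le_of_notMem (μ : Measure (Word k → X)) {e : Finset (Fin k)}
    {I : Set (Finset (Fin k))} (hI : IsUpSet I) (he : e ∉ I) :
    obliqueJoin μ I ≤ eventuallyMeasurableSpace
      (MeasurableSpace.comap (fun (x : Fin k → X) (j : {j // j ∉ e}) => x j) inferInstance)
      (ae (lineMarginal μ)) := by
  refine iSup₂_le fun u hu => ?_
  -- Otherwise u ⊆ e would put e into the up-set. The oblique copy for u can then be read at the
  -- coordinate j.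
  obtain ⟨j, hju, hje⟩ : ∃ j ∈ u, j ∉ e := by
    by_contra! h
    exact he (hI.2 h hu)
  rw [oblique_eq μ u j hju]
  refine eventuallyMeasurableSpace_mono ?_ _
  rintro _ ⟨A, hA, rfl⟩
  exact ⟨{z | z ⟨j, hje⟩ ∈ A}, measurable_pi_apply _ hA.1, rfl⟩

theorem comap_insensitiveJoin_le (μ : Measure (Word k → X)) {I : Set (Finset (Fin k))} {i : Fin k}
    (hi : ∀ u ∈ I, i ∈ u) :
    (insensitiveJoin μ I).comap (fun x : Fin k → X => x i) ≤ obliqueJoin μ I := by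
  rw [insensitiveJoin, MeasurableSpace.comap_iSup]
  refine iSup_mono fun u => ?_
  rw [MeasurableSpace.comap_iSup]
  refine iSup_mono fun hu => ?_
  rw [oblique_eq μ u i (hi u hu)]
  exact le_eventuallyMeasurableSpace

/-- The witness is a function of one coordinate i ∈ e, namely the projection of 1_{A₀} evaluated at
x_i. Since i lies in every u ⊋ e, it is measurable over their oblique join; events of Φ†_I only
involve coordinates outside e, where `measureReal_line_eq_setIntegral_condExp` applies. -/
theorem exists_oblique_projection [NeZero k] [StandardBorelSpace X] {μ : Measure (Word k → X)}
    [IsProbabilityMeasure μ] (hss : IsStronglyStationary μ) {e : Finset (Fin k)}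
    (he : e.Nonempty) (hsat : IsSated μ {u | e ⊂ u}) {I : Set (Finset (Fin k))} (hI : IsUpSet I)
    (heI : e ∉ I) {A : Set (Fin k → X)} (hA : MeasurableSet[oblique μ e] A) :
    ∃ h : NullMeasurableSpace (Fin k → X) (lineMarginal μ) → ℝ,
      StronglyMeasurable[obliqueJoin μ {u | e ⊂ u}] h ∧
      Integrable h (lineMarginal μ).completion ∧
      ∀ B, MeasurableSet[obliqueJoin μ I] B →
        (lineMarginal μ).completion.real (A ∩ B) = ∫ x in B, h x ∂(lineMarginal μ).completion := by
  obtain ⟨i, hi⟩ := he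
  rw [oblique_eq μ e i hi] at hA
  obtain ⟨_, ⟨A₀, hA₀, rfl⟩, hAA₀⟩ := hA
  have hmarg : (lineMarginal μ).map (fun x => x i) = pointMarginal μ := by
    rw [← map_eval_eq_pointMarginal hss (Word.letter i)]
    unfold lineMarginal
    rw [Measure.map_map (measurable_pi_apply i) (by fun_prop)]
    rfl
  obtain ⟨h₀, hh₀⟩ : ∃ h₀ : X → ℝ, h₀ = (pointMarginal μ)[A₀.indicator (fun _ => (1 : ℝ)) |
    insensitiveJoin μ {u | e ⊂ u}] := ⟨_, rfl⟩
  have hsm : StronglyMeasurable[insensitiveJoin μ {u | e ⊂ u}] h₀ :=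
    hh₀ ▸ stronglyMeasurable_condExp
  have hint : Integrable h₀ (pointMarginal μ) := hh₀ ▸ integrable_condExp
  have hsmi : StronglyMeasurable fun x : Fin k → X => h₀ (x i) :=
    (hsm.mono (insensitiveJoin_le μ _)).comp_measurable (measurable_pi_apply i)
  refine ⟨fun x => h₀ (ofNull (lineMarginal μ) x i), ?_, ?_, fun B hB => ?_⟩
  · exact (hsm.comp_measurable (comap_measurable fun x : Fin k → X => x i)).mono
      (comap_insensitiveJoin_le μ fun u hu => hu.1 hi)
  · have hg := (measurable_pi_apply (X := fun _ : Fin k => X) i).comp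
      (measurable_ofNull (lineMarginal μ))
    refine (integrable_map_measure (hsm.mono (insensitiveJoin_le μ _)).aestronglyMeasurable
      hg.aemeasurable).1 ?_
    rw [← Measure.map_map (measurable_pi_apply i) (measurable_ofNull _), map_ofNull_completion,
      hmarg]
    exact hint
  · obtain ⟨_, ⟨D, hD, rfl⟩, hBD⟩ := obliqueJoin_le_of_notMem μ hI heI B hB
    have h1 := measureReal_line_eq_setIntegral_condExp hss hi hsat hA₀ hD
    rw [← hh₀] at h1
    have hD' : MeasurableSet {x : Fin k → X | (fun j : {j // j ∉ e} => x j) ∈ D} :=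
      (show Measurable fun (x : Fin k → X) (j : {j // j ∉ e}) => x j by fun_prop) hD
    rw [← setIntegral_completion (lineMarginal μ) hsmi hD'] at h1
    refine Eq.trans ?_ (h1.trans (setIntegral_congr_set ?_).symm)
    · exact (measureReal_congr (μ := lineMarginal μ) (hAA₀.inter hBD))
    · exact hBD

end Completion

theorem theorem6p3 {k : ℕ} [NeZero k] {X : Type u} [MeasurableSpace X] [StandardBorelSpace X]
    (μ : Measure (Word k → X)) [IsProbabilityMeasure μ]
    (hss : IsStronglyStationary μ) (hsat : IsFullySated μ)
    (I I' : Set (Finset (Fin k))) (hI : IsUpSet I) (hI' : IsUpSet I') :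
    RelIndep (lineMarginal μ).completion
      (obliqueJoin μ (I ∩ I')) (obliqueJoin μ I) (obliqueJoin μ I') := by
  have hL : IsProbabilityMeasure (lineMarginal μ) :=
    Measure.isProbabilityMeasure_map (Measurable.aemeasurable (by fun_prop))
  have hO := fun (e : Finset (Fin k)) (he : e.Nonempty) => oblique_le μ he
  have hle : ∀ I : Set (Finset (Fin k)), IsUpSet I → obliqueJoin μ I ≤
      (inferInstance : MeasurableSpace (NullMeasurableSpace (Fin k → X) (lineMarginal μ))) :=
    fun I hI => iSup₂_le fun u hu => oblique_le μ (hI.nonempty_of_mem hu)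
  refine SplitsOver.relIndep (Ω := NullMeasurableSpace (Fin k → X) (lineMarginal μ))
    (splitsOver_join (Ω := NullMeasurableSpace (Fin k → X) (lineMarginal μ)) (O := oblique μ) hO ?_ hI hI')
    (biSup_mono Set.inter_subset_left) (hle I hI) (hle I' hI')
  intro e I'' he hI'' heI A hA
  have hsatJ : IsSated μ {u | e ⊂ u} := by
    rcases Set.eq_empty_or_nonempty {u | e ⊂ u} with h | h
    · rw [h]
      exact isSated_empty μ
    · exact hsat _ h (isUpSet_ssuperset he)
  exact exists_oblique_projection hss he hsatJ hI'' heI hA
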